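/- Let $\mathcal G=(V,E)$ be a finite connected graph (loops and multiple edges are allowed) with positive conductances $c(e)$, $e\in E$, which has at least one cycle and is embedded in the plane. The embedding is given combinatorially, by a rotation system: for each vertex a cyclic order of the directed edges that start there. The faces are the orbits of the map that sends a directed edge to the directed edge following its reversal in the cyclic order around its endpoint, and planarity means that $|V|-|E|+|V^*|=2$, where $V^*$ is the set of faces. One face $b^*$ is chosen as the outer face. The dual graph $\mathcal G^*$ has vertex set $V^*$ and, for every $e\in E$, an edge $e^*$ of conductance $c(e^*)=1/c(e)$ which joins the faces on the two sides of $e$. A unicycle is a connected spanning subgraph $(V,U)$, $U\subseteq E$, which contains exactly one cycle. Let $\kappa(\mathcal G)=\sum_{T}\prod_{e\in T}c(e)$ and $\lambda(\mathcal G)=\sum_{U}\prod_{e\in U}c(e)$, where the sums are over the spanning trees and over the unicycles of $\mathcal G$. Let $\mathbb P$ be the probability measure on unicycles with $\mathbb P(U)=\lambda(\mathcal G)^{-1}\prod_{e\in U}c(e)$, and $\mathbb E$ its expectation. A face is enclosed by a cycle if every path of faces from it to $b^*$ (a path in $\mathcal G^*$) crosses an edge of the cycle. Let $A$ denote the area of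 the unique cycle of the random unicycle, that is, the number of faces that the cycle encloses. Let $G^*$ be the Green's function of $\mathcal G^*$ with Dirichlet boundary condition at $b^*$: the inverse of the matrix of the Laplacian $\Delta h(v)=\sum_{e^*=vv'}c(e^*)(h(v)-h(v'))$ with the row and the column of $b^*$ removed, and $G^*_{f,f'}=0$ if $f=b^*$ or $f'=b^*$. Theorem. For all faces $f,f'$ of $\mathcal G$, $$\mathbb P(f\text{ enclosed})=\frac{\kappa(\mathcal G)}{\lambda(\mathcal G)}\,G^*_{f,f},\qquad \mathbb P(f,f'\text{ enclosed})=\frac{\kappa(\mathcal G)}{\lambda(\mathcal G)}\,G^*_{f,f'}.$$ Moreover, $$\mathbb E(A)=\frac{\kappa(\mathcal G)}{\lambda(\mathcal G)}\sum_{v^*\in V^*}G^*_{v^*,v^*},\qquad \mathbb E(A^2)=\frac{\kappa(\mathcal G)}{\lambda(\mathcal G)}\,|V^*|\,\mathbb E(\tau_{b^*}),$$ where $\mathbb E(\tau_{b^*})$, which is finite, is the expected hitting time of $b^*$ for the conductance-biased random walk on $\mathcal G^*$ in continuous time (which jumps from $v$ to $v'\ne v$ at rate equal to the total conductance between $v$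 and $v'$), started at a uniformly chosen vertex of $\mathcal G^*$ ($b^*$ included). -/

import Mathlib

open MeasureTheory

open scoped ENNReal

/-- A multigraph with vertex set `V` and edge set `E`; loops and multiple edges are allowed.
The names `src`, `tgt` of the two ends of an edge are an arbitrary choice: no notion below
depends on which end is called which. -/
structure MGraph (V E : Type*) where
  src : E → V
  tgt : E → V

namespace MGraph

variable {V E : Type*} (G : MGraph V E)

/-- The edge `e` has ends `u` and `v`. -/
def Joins (e : E) (u v : V) : Prop :=
  (G.src e = u ∧ G.tgt e = v) ∨ (G.src e = v ∧ G.tgt e = u)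

/-- `v` can be reached from `u` by a walk that uses only edges in `S`. -/
def Reachable (S : Set E) : V → V → Prop :=
  Relation.ReflTransGen fun u v => ∃ e ∈ S, G.Joins e u v

/-- The spanning subgraph `(V, S)` is connected. -/
def ConnectedOn (S : Set E) : Prop :=
  Nonempty V ∧ ∀ u v, G.Reachable S u v

/-- The graph is connected. -/
def Connected : Prop := G.ConnectedOn Set.univ

/-- `C` is the edge set of a cycle `v₀, e₀, v₁, e₁, …, vₙ, eₙ, v₀` with distinct vertices and
distinct edges. A loop is a cycle of length one, two parallel edges form a cycle of length two.
(Addition in `Fin (n + 1)` is cyclic.) -/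
def IsCycle (C : Set E) : Prop :=
  ∃ (n : ℕ) (v : Fin (n + 1) → V) (e : Fin (n + 1) → E),
    Function.Injective v ∧ Function.Injective e ∧
      (∀ i, G.Joins (e i) (v i) (v (i + 1))) ∧ C = Set.range e

/-- Spanning trees, as sets of edges. -/
def IsSpanningTree (A : Finset E) : Prop :=
  G.ConnectedOn (A : Set E) ∧ ∀ C : Set E, C ⊆ A → ¬ G.IsCycle C

/-- Cycle-rooted spanning trees (unicycles): connected spanning subgraphs with a unique cycle. -/
def IsUnicycle (A : Finset E) : Prop :=
  G.ConnectedOn (A : Set E) ∧ ∃! C : Set E, C ⊆ A ∧ G.IsCycle C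

/-- The type of unicycles of `G`. -/
def Unicycle : Type _ := {A : Finset E // G.IsUnicycle A}

variable {G} in
/-- The edge set of the unique cycle of a unicycle. -/
noncomputable def Unicycle.cycle (U : G.Unicycle) : Set E := U.2.2.choose

noncomputable instance [Fintype E] : Fintype G.Unicycle := by
  classical exact inferInstanceAs (Fintype {A : Finset E // G.IsUnicycle A})

section Weighted

variable (c : E → ℝ)

open scoped Classical in
/-- `κ`, the weighted sum of the spanning trees. -/
noncomputable def treeSum [Fintype E] : ℝ :=
  ∑ A : Finset E with G.IsSpanningTree A, ∏ e ∈ A, c e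

/-- The weight of a unicycle. -/
noncomputable def Unicycle.weight {G : MGraph V E} (U : G.Unicycle) (c : E → ℝ) : ℝ :=
  ∏ e ∈ U.1, c e

/-- `λ`, the weighted sum of the unicycles. -/
noncomputable def unicycleSum [Fintype E] : ℝ :=
  ∑ U : G.Unicycle, U.weight c

/-- The expectation of `X` at a random unicycle, chosen with probability proportional to
its weight. -/
noncomputable def unicycleExp [Fintype E] (X : G.Unicycle → ℝ) : ℝ :=
  ∑ U : G.Unicycle, (U.weight c / G.unicycleSum c) * X U

open scoped Classical in
/-- The probability of the event `p` for a random unicycle, chosen with probability proportional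
to its weight. -/
noncomputable def unicycleProb [Fintype E] (p : G.Unicycle → Prop) : ℝ :=
  ∑ U : G.Unicycle with p U, U.weight c / G.unicycleSum c

open scoped Classical in
/-- The total conductance between `u` and `v`. -/
noncomputable def cond [Fintype E] (u v : V) : ℝ := ∑ e : E with G.Joins e u v, c e

open scoped Classical in
/-- The total conductance between `u` and the other vertices. -/
noncomputable def rate [Fintype V] [Fintype E] (u : V) : ℝ :=
  ∑ v : V with v ≠ u, G.cond c u v

open scoped Classical in
/-- The matrix of the Laplacian `Δ f(u) = ∑ v, c(u, v) (f(u) - f(v))` (loops do not contribute). -/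
noncomputable def laplacian [Fintype V] [Fintype E] : Matrix V V ℝ :=
  Matrix.of fun u v => if u = v then G.rate c u else - G.cond c u v

/-- The Dirichlet Laplacian: the row and the column of `b` are removed. -/
noncomputable def dirichletLaplacian [Fintype V] [Fintype E] (b : V) :
    Matrix {v // v ≠ b} {v // v ≠ b} ℝ :=
  (G.laplacian c).submatrix Subtype.val Subtype.val

open scoped Classical in
/-- The Green's function with Dirichlet boundary conditions at `b`: the inverse of the Dirichlet
Laplacian, extended by zero to `b`. -/
noncomputable def green [Fintype V] [Fintype E] (b u v : V) : ℝ :=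
  if h : u ≠ b ∧ v ≠ b then (G.dirichletLaplacian c b)⁻¹ ⟨u, h.1⟩ ⟨v, h.2⟩ else 0

open scoped Classical in
/-- The jump probabilities of the conductance-biased random walk. -/
noncomputable def jumpProb [Fintype V] [Fintype E] (u v : V) : ℝ :=
  if u = v then 0 else G.cond c u v / G.rate c u

/-- The (continuous time) conductance-biased random walk, started at a uniform vertex. The walk
jumps from `u` to each `v ≠ u` at rate `c(u, v)`. It is given by the sequence `X` of the vertices
that it visits and the sequence `T` of the times that it spends there: `X` is the Markov chain
with the transition probabilities `jumpProb`, and given `X` the times `T i` are independent,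
exponentially distributed with parameter `rate (X i)`. -/
structure IsUniformWalk [Fintype V] [Fintype E] {Ω : Type*} [MeasurableSpace Ω]
    (μ : Measure Ω) (X : ℕ → Ω → V) (T : ℕ → Ω → ℝ) : Prop where
  isProbabilityMeasure : IsProbabilityMeasure μ
  measurableSet_eq : ∀ n x, MeasurableSet {ω | X n ω = x}
  measurable_time : ∀ n, Measurable (T n)
  law : ∀ (n : ℕ) (x : ℕ → V) (t : ℕ → ℝ), (∀ i, 0 ≤ t i) →
    μ {ω | ∀ i ≤ n, X i ω = x i ∧ t i < T i ω} =
      ENNReal.ofReal ((Fintype.card V : ℝ)⁻¹ *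
        (∏ i ∈ Finset.range n, G.jumpProb c (x i) (x (i + 1))) *
        ∏ i ∈ Finset.range (n + 1), Real.exp (- (G.rate c (x i) * t i)))

end Weighted

section Existence

open ProbabilityTheory

universe u

/-- The walk exists, for every finite graph in which every vertex has a neighbour. -/
theorem exists_isUniformWalk {V : Type u} [Fintype V] [Fintype E] [Nonempty V] (G : MGraph V E)
    (c : E → ℝ) (hc : ∀ e, 0 ≤ c e) (hr : ∀ u, 0 < G.rate c u) :
    ∃ (Ω : Type u) (_ : MeasurableSpace Ω) (μ : Measure Ω) (X : ℕ → Ω → V) (T : ℕ → Ω → ℝ),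
      G.IsUniformWalk c μ X T := by
  classical
  let _ : MeasurableSpace V := ⊤
  have : DiscreteMeasurableSpace V := ⟨fun _ => trivial⟩
  have hj0 : ∀ u v, 0 ≤ G.jumpProb c u v := fun u v => by
    unfold jumpProb
    split_ifs
    · exact le_rfl
    · exact div_nonneg (Finset.sum_nonneg fun e _ => hc e) (hr u).le
  have hj1 : ∀ u, ∑ v, G.jumpProb c u v = 1 := fun u => by
    have : ∑ v, G.jumpProb c u v = ∑ v : V with v ≠ u, G.cond c u v / G.rate c u := by
      rw [Finset.sum_filter]
      refine Finset.sum_congr rfl fun v _ => ?_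
      unfold jumpProb
      by_cases h : u = v
      · simp [h]
      · simp [h, Ne.symm h]
    rw [this, ← Finset.sum_div]
    have h2 : ∑ v : V with v ≠ u, G.cond c u v = G.rate c u := by
      unfold rate; congr!
    rw [h2, div_self (hr u).ne']
  let J : V → Measure V := fun u => ∑ v, ENNReal.ofReal (G.jumpProb c u v) • Measure.dirac v
  have hJ : ∀ u v, J u {v} = ENNReal.ofReal (G.jumpProb c u v) := fun u v => by
    simp [J, Set.indicator_apply]
  have : ∀ u, IsProbabilityMeasure (J u) := fun u => ⟨by
    simp [J, ← ENNReal.ofReal_sum_of_nonneg (fun v _ => hj0 u v), hj1]⟩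
  let U : Measure V := ∑ v : V, ENNReal.ofReal (Fintype.card V : ℝ)⁻¹ • Measure.dirac v
  have hU : ∀ v, U {v} = ENNReal.ofReal (Fintype.card V : ℝ)⁻¹ := fun v => by
    simp [U, Set.indicator_apply]
  have hcard : (0 : ℝ) < Fintype.card V := by exact_mod_cast Fintype.card_pos
  have : IsProbabilityMeasure U := ⟨by
    have : ∑ _v : V, ENNReal.ofReal (Fintype.card V : ℝ)⁻¹ = 1 := by
      rw [← ENNReal.ofReal_sum_of_nonneg (fun v _ => by positivity)]
      simp [hcard.ne']
    simpa [U] using this⟩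
  have := isProbabilityMeasure_expMeasure (r := 1) one_pos
  have hexp : ∀ a : ℝ, 0 ≤ a → expMeasure 1 (Set.Ioi a) = ENNReal.ofReal (Real.exp (-a)) := by
    intro a ha
    have h1 := cdf_expMeasure_eq (r := 1) one_pos a
    rw [if_pos ha] at h1
    rw [← Set.compl_Iic, prob_compl_eq_one_sub measurableSet_Iic, ← ofReal_cdf, h1,
      ← ENNReal.ofReal_one, ← ENNReal.ofReal_sub _ (by simp [ha])]
    congr 1; ring_nf
  let M : Measure (V → V) := Measure.pi J
  have hM : ∀ u v, M {h | h u = v} = ENNReal.ofReal (G.jumpProb c u v) := fun u v => by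
    rw [← hJ]
    exact (measurePreserving_eval J u).measure_preimage (MeasurableSet.singleton v).nullMeasurableSet
  let P : Measure (ℕ → V → V) := Measure.infinitePi fun _ => M
  let Q : Measure (ℕ → ℝ) := Measure.infinitePi fun _ => expMeasure 1
  let X : ℕ → V × (ℕ → V → V) × (ℕ → ℝ) → V := fun n ω =>
    Nat.rec ω.1 (fun k v => ω.2.1 k v) n
  have hX0 : ∀ ω, X 0 ω = ω.1 := fun _ => rfl
  have hXs : ∀ n ω, X (n + 1) ω = ω.2.1 n (X n ω) := fun _ _ => rfl
  have hXm : ∀ n, Measurable (X n) := by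
    intro n
    induction n with
    | zero => exact measurable_fst
    | succ n ih =>
      have h1 : Measurable fun ω : V × (ℕ → V → V) × (ℕ → ℝ) => ω.2.1 n := by fun_prop
      have h2 : Measurable fun p : (V → V) × V => p.1 p.2 :=
        measurable_from_prod_countable_left fun v => measurable_pi_apply v
      exact h2.comp (h1.prodMk ih)
  refine ⟨V × (ℕ → V → V) × (ℕ → ℝ), inferInstance, U.prod (P.prod Q), X,
    fun n ω => ω.2.2 n / G.rate c (X n ω), inferInstance, fun n x => hXm n (MeasurableSet.singleton x), fun n => ?_, ?_⟩
  · have h1 : Measurable fun v : V => G.rate c v := .of_discrete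
    have h2 := h1.comp (hXm n)
    exact Measurable.div (by fun_prop) h2
  · intro n x t ht
    have hset : {ω | ∀ i ≤ n, X i ω = x i ∧ t i < ω.2.2 i / G.rate c (X i ω)} =
        ({x 0} : Set V) ×ˢ
          ((Set.pi (Finset.range n : Set ℕ) fun i => {h : V → V | h (x i) = x (i + 1)}) ×ˢ
           (Set.pi (Finset.range (n + 1) : Set ℕ) fun i => Set.Ioi (G.rate c (x i) * t i))) := by
      ext ω
      simp only [Set.mem_ofPred_eq, Set.mem_prod, Set.mem_singleton_iff, Set.mem_pi,
        Finset.coe_range, Set.mem_Iio, Set.mem_Ioi]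
      constructor
      · intro h
        refine ⟨(h 0 (Nat.zero_le _)).1, fun i hi => ?_, fun i hi => ?_⟩
        · have := (h (i + 1) hi).1
          rwa [hXs, (h i hi.le).1] at this
        · have := h i (Nat.lt_succ_iff.1 hi)
          rw [this.1] at this
          rw [mul_comm]
          exact (lt_div_iff₀ (hr _)).1 this.2
      · rintro ⟨h0, h1, h2⟩
        have hx : ∀ i ≤ n, X i ω = x i := by
          intro i
          induction i with
          | zero => exact fun _ => h0
          | succ i ih => intro hi; rw [hXs, ih (by omega)]; exact h1 i hi
        intro i hi
        refine ⟨hx i hi, ?_⟩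
        rw [hx i hi, lt_div_iff₀ (hr _), mul_comm]
        exact h2 i (Nat.lt_succ_iff.2 hi)
    have hm : ∀ u v, MeasurableSet {h : V → V | h u = v} := fun u v =>
      (measurable_pi_apply (X := fun _ : V => V) u) (MeasurableSet.singleton v)
    rw [hset, Measure.prod_prod, Measure.prod_prod, hU, Measure.infinitePi_pi _ fun i _ => hm _ _,
      Measure.infinitePi_pi _ fun i _ => measurableSet_Ioi]
    simp only [hM]
    rw [Finset.prod_congr rfl fun i _ => hexp _ (mul_nonneg (hr (x i)).le (ht i)),
      ← ENNReal.ofReal_prod_of_nonneg fun i _ => hj0 _ _,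
      ← ENNReal.ofReal_prod_of_nonneg fun i _ => (Real.exp_pos _).le,
      ← ENNReal.ofReal_mul (Finset.prod_nonneg fun i _ => hj0 _ _),
      ← ENNReal.ofReal_mul (by positivity), mul_assoc]

end Existence

/-- The darts (directed edges) of a graph are the pairs `(e, true)`, the edge `e` directed from
`src e` to `tgt e`, and `(e, false)`, the same edge directed from `tgt e` to `src e`. -/
def origin (d : E × Bool) : V := if d.2 then G.src d.1 else G.tgt d.1

/-- Reversal of darts. -/
def flip (E : Type*) : Equiv.Perm (E × Bool) := Equiv.prodCongr (Equiv.refl E) Equiv.boolNot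

/-- A rotation system (combinatorial map), which describes an embedding of a graph in an oriented
surface: `rot` sends a dart to the next dart around the vertex from which it starts, so that the
cycles of `rot` are the sets of the darts that start from a given vertex. -/
structure RotationSystem where
  rot : Equiv.Perm (E × Bool)
  sameCycle_iff : ∀ d d', rot.SameCycle d d' ↔ G.origin d = G.origin d'

namespace RotationSystem

variable {G} (R : G.RotationSystem)

/-- Follow the boundary of a face: traverse a dart and then turn to the next dart around the
vertex that has been reached. -/
def facePerm : Equiv.Perm (E × Bool) := R.rot * flip E

/-- The faces are the cycles of `facePerm`: a dart is identified with the face on its side. -/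
def Face : Type _ := Quotient (Equiv.Perm.SameCycle.setoid R.facePerm)

/-- The face on the side of a dart. -/
def face (d : E × Bool) : R.Face := Quotient.mk (Equiv.Perm.SameCycle.setoid R.facePerm) d

noncomputable instance [Fintype E] : Fintype R.Face := by
  classical exact
    inferInstanceAs (Fintype (Quotient (Equiv.Perm.SameCycle.setoid R.facePerm)))

/-- The embedding of a connected graph is an embedding in the sphere (equivalently, after the
choice of an outer face, in the plane): the Euler characteristic is two. -/
def IsPlanar [Fintype V] [Fintype E] : Prop :=
  Fintype.card V + Fintype.card R.Face = Fintype.card E + 2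

/-- The dual graph: its vertices are the faces, and the dual of an edge `e`, again indexed by `e`,
joins the faces on the two sides of `e`. -/
def dual : MGraph R.Face E where
  src e := R.face (e, true)
  tgt e := R.face (e, false)

/-- The face `f` is enclosed by the cycle with edge set `C`, for the outer face `b`: one cannot
pass from `f` to `b` through the faces without crossing an edge of `C`. -/
def Encloses (b : R.Face) (C : Set E) (f : R.Face) : Prop :=
  ¬ R.dual.Reachable Cᶜ f b

/-- The area of a cycle: the number of faces that it encloses. -/
noncomputable def area (b : R.Face) (C : Set E) : ℕ := Set.ncard {f | R.Encloses b C f}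

end RotationSystem

end MGraph

open scoped Classical in
/-- The first time at which the walk that visits the vertices `X 0, X 1, …` and stays there for
the times `T 0, T 1, …` is at `b`. -/
noncomputable def hittingTime {V Ω : Type*} (X : ℕ → Ω → V) (T : ℕ → Ω → ℝ) (b : V) (ω : Ω) :
    ℝ≥0∞ :=
  ∑' n : ℕ, if ∀ m ≤ n, X m ω ≠ b then ENNReal.ofReal (T n ω) else 0

/-! Send a unit flow around the cycle of each unicycle `U`. On a connected planar graph every flow
is the gradient of a function on the faces: gradients on the dual are flows, and Euler's formula
makes the two spaces equal in dimension (`IsPlanar.exists_potential`). Normalized to vanish at `b`,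
the potential `h_U` of the unit flow is, up to a sign, the indicator of the enclosed faces
(`Unicycle.potential_eq`). The sign disappears in `h_U(f) h_U(f')`, so the weighted sum `H(f,f')` of
these products over the unicycles is `λ` times the probability that both faces are enclosed.

It remains to see that `H = κ G*`, that is, that the dual Laplacian sends `H(·,f')` to `κ δ_{f'}`
away from `b`. The Laplacian is divergence times `1/c` times gradient, and the gradient of `h_U` is
the flow. The factor `1/c(e)` removes the edge `e` of the cycle from the weight of `U`, which leaves
a spanning tree `T` and an edge `e` outside it (`sum_unicycle_erase`). For fixed `T`, the
fundamental cycles of `T`, combined with the coefficients of the boundary of `f`, give that boundary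
flow, because a flow is determined by its values off a tree; hence their potentials add up to `δ_f`
(`IsSpanningTree.sum_edgePotential`). Summing over `T` gives `κ`.

The moments of the area follow by summing over one face or over pairs of faces. For the second
moment, `g(f) = ∑ f', G*(f,f')` solves the Poisson equation with right side one, and a telescoping
sum along the walk identifies its mean with the expected hitting time
(`IsUniformWalk.lintegral_hittingTime`). -/

namespace MGraph

/-! ### Cycles, spanning trees and unicycles in terms of flows -/

section Flows

variable {V E : Type*} (G : MGraph V E)

variable {G} in
theorem Joins.symm {e : E} {u v : V} (h : G.Joins e u v) : G.Joins e v u := Or.symm h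

theorem joins_src_tgt (e : E) : G.Joins e (G.src e) (G.tgt e) := Or.inl ⟨rfl, rfl⟩

variable {G} in
theorem Reachable.symm {S : Set E} {u v : V} (h : G.Reachable S u v) : G.Reachable S v u := by
  induction h with
  | refl => exact Relation.ReflTransGen.refl
  | tail _ h ih =>
    obtain ⟨e, he, hj⟩ := h
    exact Relation.ReflTransGen.head ⟨e, he, hj.symm⟩ ih

variable {G} in
theorem Reachable.trans {S : Set E} {u v w : V} (h : G.Reachable S u v) (h' : G.Reachable S v w) :
    G.Reachable S u w := Relation.ReflTransGen.trans h h'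

variable {G} in
theorem Reachable.mono {S S' : Set E} (hS : S ⊆ S') {u v : V} (h : G.Reachable S u v) :
    G.Reachable S' u v :=
  Relation.ReflTransGen.mono (fun _ _ ⟨e, he, hj⟩ => ⟨e, hS he, hj⟩) _ _ h

variable {G} in
theorem Joins.reachable {S : Set E} {e : E} {u v : V} (h : G.Joins e u v) (he : e ∈ S) :
    G.Reachable S u v := Relation.ReflTransGen.single ⟨e, he, h⟩

/-- A function that agrees at the ends of every edge in `S` is constant along walks in `S`. -/
theorem Reachable.eq_of_forall {α : Type*} {G : MGraph V E} {S : Set E} {u v : V}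
    (h : G.Reachable S u v) (f : V → α) (hf : ∀ e ∈ S, f (G.src e) = f (G.tgt e)) : f u = f v := by
  induction h with
  | refl => rfl
  | tail _ h ih =>
    obtain ⟨e, he, hj⟩ := h
    rw [ih]
    rcases hj with ⟨rfl, rfl⟩ | ⟨rfl, rfl⟩
    · exact hf e he
    · exact (hf e he).symm

/-- A walk of minimal length is a path. -/
theorem Reachable.exists_path {G : MGraph V E} {S : Set E} {u v : V} (h : G.Reachable S u v) :
    ∃ (n : ℕ) (x : ℕ → V), x 0 = u ∧ x n = v ∧ Set.InjOn x (Set.Iic n) ∧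
      ∀ i < n, ∃ e ∈ S, G.Joins e (x i) (x (i + 1)) := by
  classical
  let P : ℕ → Prop := fun n => ∃ (x : ℕ → V), x 0 = u ∧ x n = v ∧
    ∀ i < n, ∃ e ∈ S, G.Joins e (x i) (x (i + 1))
  have hP : ∃ n, P n := by
    induction h with
    | refl => exact ⟨0, fun _ => u, rfl, rfl, by simp⟩
    | @tail a w _ h ih =>
      obtain ⟨n, x, h0, hn, hx⟩ := ih
      refine ⟨n + 1, fun i => if i ≤ n then x i else w, by simp [h0], by simp, fun i hi => ?_⟩
      rcases Nat.lt_succ_iff_lt_or_eq.1 hi with hi | rfl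
      · simpa [hi.le, Nat.succ_le_of_lt hi] using hx i hi
      · simpa [hn] using h
  obtain ⟨x, h0, hn, hx⟩ := Nat.find_spec hP
  set n := Nat.find hP with hndef
  -- A repeated vertex would allow the segment between its two visits to be cut out, which
  -- contradicts the minimality of `n`.
  have key : ∀ i j, i < j → j ≤ n → x i ≠ x j := by
    intro i j hij hj hxij
    refine Nat.find_min hP (m := n - (j - i)) (by omega)
      ⟨fun k => if k ≤ i then x k else x (k + (j - i)), by simp [h0], ?_, fun k hk => ?_⟩
    · dsimp only
      split_ifs with h
      · have : n - (j - i) = i := by omega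
        rw [this, hxij, ← hn]; congr 1; omega
      · rw [← hn]; congr 1; omega
    · dsimp only
      rcases lt_trichotomy k i with h | rfl | h
      · simpa [h.le, Nat.succ_le_of_lt h] using hx k (by omega)
      · rw [if_pos le_rfl, if_neg (by omega), hxij]
        have := hx j (by omega)
        rwa [show k + 1 + (j - k) = j + 1 by omega]
      · rw [if_neg (by omega), if_neg (by omega)]
        have := hx (k + (j - i)) (by omega)
        rwa [show k + 1 + (j - i) = k + (j - i) + 1 by omega]
  refine ⟨n, x, h0, hn, fun i hi j hj hij => ?_, hx⟩
  rcases lt_trichotomy i j with h | h | h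
  · exact absurd hij (key i j h hj)
  · exact h
  · exact absurd hij.symm (key j i h hi)

/-- An edge and a walk between its ends that avoids it contain a cycle through the edge. -/
theorem Reachable.exists_isCycle {G : MGraph V E} {S : Set E} {u v : V} (h : G.Reachable S u v)
    {e₀ : E} (he₀ : e₀ ∉ S) (hj : G.Joins e₀ v u) : ∃ C, G.IsCycle C ∧ C ⊆ insert e₀ S := by
  obtain ⟨n, x, rfl, rfl, hinj, hx⟩ := h.exists_path
  -- The path supplies the edges with index below `n`; the last index is reserved for `e₀`, which
  -- closes the path.
  have : ∀ i : Fin (n + 1), ∃ e, (i < Fin.last n → e ∈ S ∧ G.Joins e (x i) (x (i + 1))) ∧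
      (i = Fin.last n → e = e₀) := fun i => by
    by_cases hi : i = Fin.last n
    · exact ⟨e₀, fun h => absurd hi h.ne, fun _ => rfl⟩
    · obtain ⟨e, he⟩ := hx i (Fin.lt_last_iff_ne_last.2 hi)
      exact ⟨e, fun _ => he, fun h => absurd h hi⟩
  choose e he he' using this
  refine ⟨Set.range e, ⟨n, fun i => x i, e, fun i j hij => ?_, fun i j hij => ?_, fun i => ?_, rfl⟩,
    ?_⟩
  · exact Fin.ext (hinj (Set.mem_Iic.2 (Nat.lt_succ_iff.1 i.2))
      (Set.mem_Iic.2 (Nat.lt_succ_iff.1 j.2)) hij)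
  · rcases (Fin.le_last i).lt_or_eq with hi | hi <;> rcases (Fin.le_last j).lt_or_eq with hj' | hj'
    · have h1 := (he i hi).2
      have h2 := (he j hj').2
      rw [hij] at h1
      have hi' : (i : ℕ) < n := hi
      have hj'' : (j : ℕ) < n := hj'
      have inj : ∀ {a b : ℕ}, a ≤ n → b ≤ n → x a = x b → a = b :=
        fun ha hb hab => hinj (Set.mem_Iic.2 ha) (Set.mem_Iic.2 hb) hab
      apply Fin.ext
      -- If two steps use the same edge, they agree in direction, hence have the same index, or they
      -- are opposite, which would give `i = j + 1` and `i + 1 = j`.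
      rcases h1 with ⟨a1, b1⟩ | ⟨a1, b1⟩ <;> rcases h2 with ⟨a2, b2⟩ | ⟨a2, b2⟩
      · exact inj hi'.le hj''.le (a1.symm.trans a2)
      · have := inj (by omega) (by omega) (a1.symm.trans a2)
        have := inj (by omega) (by omega) (b1.symm.trans b2)
        omega
      · have := inj (by omega) (by omega) (a1.symm.trans a2)
        have := inj (by omega) (by omega) (b1.symm.trans b2)
        omega
      · exact inj hi'.le hj''.le (b1.symm.trans b2)
    · exact absurd (he' j hj' ▸ hij ▸ (he i hi).1) he₀
    · exact absurd (he' i hi ▸ hij ▸ (he j hj').1) he₀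
    · rw [hi, hj']
  · rcases (Fin.le_last i).lt_or_eq with hi | hi
    · have := (he i hi).2
      rwa [← Fin.val_add_one_of_lt hi] at this
    · rw [he' i hi, hi]
      simpa using hj
  · rintro _ ⟨i, rfl⟩
    rcases (Fin.le_last i).lt_or_eq with hi | hi
    · exact Or.inr (he i hi).1
    · exact Or.inl (he' i hi)

open scoped Classical in
/-- The signed incidence matrix of a graph. -/
noncomputable def incidence : Matrix E V ℝ :=
  Matrix.of fun e v => (if G.tgt e = v then 1 else 0) - if G.src e = v then 1 else 0

theorem incidence_mulVec [Fintype V] (h : V → ℝ) (e : E) :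
    (G.incidence.mulVec h) e = h (G.tgt e) - h (G.src e) := by
  classical
  simp [incidence, Matrix.mulVec, dotProduct, sub_mul, Finset.sum_sub_distrib]

/-- Flows satisfy Kirchhoff's node law. -/
def IsFlow [Fintype E] (θ : E → ℝ) : Prop := Matrix.vecMul θ G.incidence = 0

variable {G}

theorem IsFlow.sub [Fintype E] {θ φ : E → ℝ} (hθ : G.IsFlow θ) (hφ : G.IsFlow φ) :
    G.IsFlow (θ - φ) := by
  unfold IsFlow at *
  rw [Matrix.sub_vecMul, hθ, hφ, sub_zero]

theorem IsFlow.smul [Fintype E] {θ : E → ℝ} (hθ : G.IsFlow θ) (a : ℝ) : G.IsFlow (a • θ) := by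
  unfold IsFlow at *
  rw [Matrix.smul_vecMul, hθ, smul_zero]

theorem IsFlow.sum [Fintype E] {ι : Type*} {s : Finset ι} {θ : ι → E → ℝ}
    (hθ : ∀ i ∈ s, G.IsFlow (θ i)) : G.IsFlow (∑ i ∈ s, θ i) := by
  classical
  induction s using Finset.induction_on with
  | empty => simp [IsFlow]
  | insert a s ha ih =>
    rw [Finset.sum_insert ha]
    have h1 := hθ a (Finset.mem_insert_self _ _)
    have h2 := ih fun i hi => hθ i (Finset.mem_insert_of_mem hi)
    unfold IsFlow at *
    rw [Matrix.add_vecMul, h1, h2, add_zero]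

theorem IsFlow.sum_mul_sub [Fintype V] [Fintype E] {θ : E → ℝ} (hθ : G.IsFlow θ) (h : V → ℝ) :
    ∑ e, θ e * (h (G.tgt e) - h (G.src e)) = 0 := by
  have := Matrix.dotProduct_mulVec θ G.incidence h
  rw [hθ, zero_dotProduct] at this
  simpa [dotProduct, incidence_mulVec] using this

/-- The ends of an edge that carries a flow are joined by other edges that carry it. -/
theorem IsFlow.reachable [Fintype V] [Fintype E] {θ : E → ℝ} (hθ : G.IsFlow θ) {e : E}
    (he : θ e ≠ 0) : G.Reachable {e' | θ e' ≠ 0 ∧ e' ≠ e} (G.tgt e) (G.src e) := by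
  classical
  by_contra hcon
  set S := {e' | θ e' ≠ 0 ∧ e' ≠ e}
  -- Test the flow against the indicator of the component of `tgt e`: of the edges that carry flow,
  -- only `e` could cross this cut, but the net flow across a cut is zero.
  have := hθ.sum_mul_sub fun x => if G.Reachable S (G.tgt e) x then 1 else 0
  rw [Finset.sum_eq_single e] at this
  · rw [if_neg hcon, if_pos (show G.Reachable S _ _ from Relation.ReflTransGen.refl)] at this
    simp [he] at this
  · intro e' _ hne
    by_cases h : θ e' = 0
    · simp [h]
    · have hr : G.Reachable S (G.src e') (G.tgt e') :=
        (G.joins_src_tgt e').reachable (S := S) ⟨h, hne⟩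
      have : G.Reachable S (G.tgt e) (G.src e') ↔ G.Reachable S (G.tgt e) (G.tgt e') :=
        ⟨fun h => h.trans hr, fun h => h.trans hr.symm⟩
      simp [this]
  · simp

/-- The support of a nonzero flow contains a cycle. -/
theorem IsFlow.exists_isCycle [Fintype V] [Fintype E] {θ : E → ℝ} (hθ : G.IsFlow θ)
    (h : θ ≠ 0) : ∃ C, G.IsCycle C ∧ C ⊆ {e | θ e ≠ 0} := by
  obtain ⟨e, he⟩ := Function.ne_iff.1 h
  obtain ⟨C, hC, hsub⟩ := (hθ.reachable he).exists_isCycle (e₀ := e) (by simp)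
    (G.joins_src_tgt e)
  refine ⟨C, hC, hsub.trans ?_⟩
  rintro e' (rfl | h')
  · exact he
  · exact h'.1

/-- A cycle carries a flow of strength one. -/
theorem IsCycle.exists_isFlow [Fintype E] {C : Set E} (hC : G.IsCycle C) :
    ∃ θ : E → ℝ, G.IsFlow θ ∧ (∀ e ∈ C, θ e * θ e = 1) ∧ ∀ e ∉ C, θ e = 0 := by
  classical
  obtain ⟨n, v, e, -, he, hj, rfl⟩ := hC
  -- The sign `s` records whether the cycle traverses the edge from `src` to `tgt` or backwards.
  have : ∀ i, ∃ s : ℝ, s * s = 1 ∧ ∀ x, s * G.incidence (e i) x =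
      (if v (i + 1) = x then 1 else 0) - if v i = x then 1 else 0 := by
    intro i
    rcases hj i with ⟨h1, h2⟩ | ⟨h1, h2⟩
    · exact ⟨1, by norm_num, fun x => by simp [incidence, h1, h2]⟩
    · exact ⟨-1, by norm_num, fun x => by simp [incidence, h1, h2]⟩
  choose s hs hs' using this
  refine ⟨fun a => ∑ i, if e i = a then s i else 0, ?_, ?_, ?_⟩
  · ext x
    simp only [Matrix.vecMul, dotProduct, Pi.zero_apply, Finset.sum_mul, ite_mul, zero_mul]
    rw [Finset.sum_comm]
    simp only [Finset.sum_ite_eq, Finset.mem_univ, if_true, hs', Finset.sum_sub_distrib]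
    rw [sub_eq_zero]
    exact Equiv.sum_comp (Equiv.addRight (1 : Fin (n + 1))) fun i => if v i = x then (1 : ℝ) else 0
  · rintro _ ⟨i, rfl⟩
    simp [he.eq_iff, hs]
  · intro a ha
    exact Finset.sum_eq_zero fun i _ => if_neg fun h => ha ⟨i, h⟩

theorem IsCycle.nonempty {C : Set E} (hC : G.IsCycle C) : C.Nonempty := by
  obtain ⟨n, v, e, -, -, -, rfl⟩ := hC
  exact ⟨e 0, 0, rfl⟩

/-- A spanning tree carries no nonzero flow. -/
theorem IsSpanningTree.eq_zero_of_isFlow [Fintype V] [Fintype E] {A : Finset E}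
    (hA : G.IsSpanningTree A) {θ : E → ℝ} (hθ : G.IsFlow θ) (h : ∀ e ∉ A, θ e = 0) : θ = 0 := by
  by_contra h0
  obtain ⟨C, hC, hsub⟩ := hθ.exists_isCycle h0
  refine hA.2 C (fun e he => ?_) hC
  by_contra h'
  exact hsub he (h e h')

namespace Unicycle

theorem cycle_subset (U : G.Unicycle) : U.cycle ⊆ U.1 := U.2.2.choose_spec.1.1

theorem isCycle_cycle (U : G.Unicycle) : G.IsCycle U.cycle := U.2.2.choose_spec.1.2

theorem eq_cycle (U : G.Unicycle) {C : Set E} (hC : G.IsCycle C) (h : C ⊆ U.1) : C = U.cycle :=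
  U.2.2.choose_spec.2 C ⟨h, hC⟩

/-- A flow of strength one around the cycle of a unicycle. -/
noncomputable def flow [Fintype E] (U : G.Unicycle) : E → ℝ := U.isCycle_cycle.exists_isFlow.choose

variable [Fintype E] (U : G.Unicycle)

theorem isFlow_flow : G.IsFlow U.flow := U.isCycle_cycle.exists_isFlow.choose_spec.1

theorem flow_mul_self {e : E} (he : e ∈ U.cycle) : U.flow e * U.flow e = 1 :=
  U.isCycle_cycle.exists_isFlow.choose_spec.2.1 e he

theorem flow_eq_zero {e : E} (he : e ∉ U.cycle) : U.flow e = 0 :=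
  U.isCycle_cycle.exists_isFlow.choose_spec.2.2 e he

theorem flow_ne_zero {e : E} (he : e ∈ U.cycle) : U.flow e ≠ 0 := fun h => by
  simpa [h] using U.flow_mul_self he

/-- A flow on a unicycle is determined by its value at an edge of the cycle. -/
theorem eq_smul_flow [Fintype V] {e : E} (he : e ∈ U.cycle) {φ : E → ℝ} (hφ : G.IsFlow φ)
    (h : ∀ a ∉ U.1, φ a = 0) : φ = (φ e * U.flow e) • U.flow := by
  -- The difference is a flow on `U` that vanishes at `e`. If it were nonzero, its support would
  -- contain a cycle, necessarily the one of `U`, which passes through `e`.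
  by_contra hne
  obtain ⟨C, hC, hsub⟩ :=
    (hφ.sub (U.isFlow_flow.smul (φ e * U.flow e))).exists_isCycle (sub_ne_zero.2 hne)
  have hCU : C ⊆ U.1 := fun a ha => by
    by_contra h'
    exact hsub ha (by simp [h a h', U.flow_eq_zero fun h'' => h' (U.cycle_subset h'')])
  refine hsub (U.eq_cycle hC hCU ▸ he) ?_
  simp [mul_assoc, U.flow_mul_self he]

end Unicycle

/-- Removing an edge of the cycle turns a unicycle into a spanning tree. -/
theorem Unicycle.isSpanningTree_erase [Fintype V] [Fintype E] [DecidableEq E] (U : G.Unicycle)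
    {e : E} (he : e ∈ U.cycle) : G.IsSpanningTree (U.1.erase e) := by
  refine ⟨⟨U.2.1.1, fun u v => ?_⟩, fun C hsub hC => ?_⟩
  · have hr : G.Reachable (U.1.erase e : Finset E) (G.tgt e) (G.src e) :=
      (U.isFlow_flow.reachable (U.flow_ne_zero he)).mono fun a ha => by
        have : a ∈ U.cycle := by
          by_contra h
          exact ha.1 (U.flow_eq_zero h)
        exact Finset.mem_coe.2 (Finset.mem_erase.2 ⟨ha.2, U.cycle_subset this⟩)
    have h := U.2.1.2 u v
    induction h with
    | refl => exact Relation.ReflTransGen.refl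
    | tail _ h ih =>
      refine Reachable.trans ih ?_
      obtain ⟨a, ha, hj⟩ := h
      by_cases hae : a = e
      · subst hae
        rcases hj with ⟨rfl, rfl⟩ | ⟨rfl, rfl⟩
        · exact hr.symm
        · exact hr
      · exact hj.reachable (Finset.mem_coe.2 (Finset.mem_erase.2 ⟨hae, ha⟩))
  · have h1 := U.eq_cycle hC fun a ha => Finset.mem_of_mem_erase (hsub ha)
    have := hsub (h1 ▸ he)
    simp at this

/-- Adding an edge turns a spanning tree into a unicycle. -/
theorem IsSpanningTree.isUnicycle_insert [Fintype V] [Fintype E] [DecidableEq E] {A : Finset E}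
    (hA : G.IsSpanningTree A) {e : E} (he : e ∉ A) : G.IsUnicycle (insert e A) := by
  refine ⟨⟨hA.1.1, fun u v => (hA.1.2 u v).mono (by simp)⟩, ?_⟩
  obtain ⟨C, hC, hsub⟩ := (hA.1.2 (G.tgt e) (G.src e)).exists_isCycle (e₀ := e) (by simpa using he)
    (G.joins_src_tgt e)
  refine ⟨C, ⟨by simpa using hsub, hC⟩, fun C' ⟨hsub', hC'⟩ => ?_⟩
  have hsub'' : C' ⊆ insert e (A : Set E) := by simpa using hsub'
  have key : ∀ {C}, C ⊆ insert e (A : Set E) → G.IsCycle C → e ∈ C := fun {C} h hC => by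
    by_contra h'
    exact hA.2 C (fun a ha => (h ha).resolve_left fun hae => h' (hae ▸ ha)) hC
  obtain ⟨θ, hθ, hθ1, hθ0⟩ := hC.exists_isFlow
  obtain ⟨θ', hθ', hθ1', hθ0'⟩ := hC'.exists_isFlow
  have h1 := hθ1 e (key hsub hC)
  have h1' := hθ1' e (key hsub'' hC')
  -- The combination is chosen to cancel at `e`, so it lives on the tree and is zero. The two flows
  -- are then proportional with nonzero factors, and their supports `C` and `C'` coincide.
  have hz := hA.eq_zero_of_isFlow ((hθ'.smul (θ e)).sub (hθ.smul (θ' e))) fun a ha => by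
    by_cases hae : a = e
    · subst hae
      simp [mul_comm]
    · have h2 : a ∉ C := fun h => (hsub h).elim hae ha
      have h2' : a ∉ C' := fun h => (hsub'' h).elim hae ha
      simp [hθ0 a h2, hθ0' a h2']
  have hz' : ∀ a, θ e * θ' a = θ' e * θ a := fun a => by
    have := congrFun hz a
    simpa [sub_eq_zero] using this
  have hne : θ e ≠ 0 := fun h => by simp [h] at h1
  have hne' : θ' e ≠ 0 := fun h => by simp [h] at h1'
  ext a
  have e1 : a ∈ C ↔ θ a ≠ 0 :=
    ⟨fun h h0 => by simpa [h0] using hθ1 a h, fun h => by by_contra h'; exact h (hθ0 a h')⟩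
  have e1' : a ∈ C' ↔ θ' a ≠ 0 :=
    ⟨fun h h0 => by simpa [h0] using hθ1' a h, fun h => by by_contra h'; exact h (hθ0' a h')⟩
  rw [e1, e1']
  have := hz' a
  constructor
  · intro h h0
    rw [h0, mul_zero] at this
    exact (mul_ne_zero hne h) this
  · intro h h0
    rw [h0, mul_zero] at this
    exact (mul_ne_zero hne' h) this.symm

theorem IsSpanningTree.mem_cycle_of_eq_insert [DecidableEq E] {A : Finset E}
    (hA : G.IsSpanningTree A) {e : E} (U : G.Unicycle) (hU : U.1 = insert e A) : e ∈ U.cycle := by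
  by_contra h
  refine hA.2 _ (fun a ha => ?_) U.isCycle_cycle
  have : a ∈ insert e A := hU ▸ U.cycle_subset ha
  exact (Finset.mem_insert.1 this).resolve_left fun hae => h (hae ▸ ha)

end Flows
end MGraph

namespace MGraph

/-! ### Planar duality: flows are gradients on the dual graph -/

section Planar

variable {V E : Type*} {G : MGraph V E}

theorem incidence_mulVec_one [Fintype V] (a : ℝ) : G.incidence.mulVec (fun _ => a) = 0 := by
  ext e
  simp [incidence_mulVec]

/-- On a connected graph, the functions with zero gradient are constant. -/
theorem Connected.eq_of_incidence_mulVec_eq_zero [Fintype V] (hG : G.Connected) {h : V → ℝ}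
    (hh : G.incidence.mulVec h = 0) (u v : V) : h u = h v := by
  refine (hG.2 u v).eq_of_forall h fun e _ => ?_
  have := congrFun hh e
  rw [incidence_mulVec] at this
  simp only [Pi.zero_apply] at this
  linarith

/-- Rank and nullity: the kernel of the gradient consists of the constants. This is needed both for
the graph and for its dual. -/
theorem Connected.rank_incidence [Fintype V] [Fintype E] (hG : G.Connected) :
    G.incidence.rank + 1 = Fintype.card V := by
  obtain ⟨v₀⟩ := hG.1
  have h1 : Module.finrank ℝ (LinearMap.ker G.incidence.mulVecLin) = 1 := by
    refine (finrank_eq_one_iff_of_nonzero' ⟨fun _ => 1, incidence_mulVec_one 1⟩ ?_).2 ?_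
    · intro h
      have := congrFun (congrArg Subtype.val h) v₀
      simp at this
    · rintro ⟨h, hh⟩
      refine ⟨h v₀, Subtype.ext (funext fun v => ?_)⟩
      simpa using hG.eq_of_incidence_mulVec_eq_zero hh v₀ v
  have h2 := LinearMap.finrank_range_add_finrank_ker G.incidence.mulVecLin
  rw [h1, Module.finrank_fintype_fun_eq_card] at h2
  exact h2

namespace RotationSystem

variable (R : G.RotationSystem)

/-- `facePerm` maps `flip d` to `rot d`, since `flip` is an involution. -/
theorem face_rot (d : E × Bool) : R.face (R.rot d) = R.face (flip E d) := by
  refine Quotient.sound ?_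
  refine Equiv.Perm.SameCycle.symm ⟨1, ?_⟩
  obtain ⟨e, s⟩ := d
  simp [facePerm, flip]

theorem origin_rot (d : E × Bool) : G.origin (R.rot d) = G.origin d :=
  ((R.sameCycle_iff _ _).1 ⟨1, by simp⟩).symm

variable {R}

/-- The dual of a connected graph is connected. -/
theorem dual_connected (hG : G.Connected) (b : R.Face) : R.dual.Connected := by
  refine ⟨⟨b⟩, fun f f' => ?_⟩
  induction f using Quotient.inductionOn with | _ d₀
  induction f' using Quotient.inductionOn with | _ d₁
  change R.dual.Reachable _ (R.face d₀) (R.face d₁)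
  have hflip : ∀ d, R.dual.Reachable Set.univ (R.face d) (R.face (flip E d)) := by
    rintro ⟨e, _ | _⟩
    · exact ((R.dual.joins_src_tgt e).reachable (Set.mem_univ e)).symm
    · exact (R.dual.joins_src_tgt e).reachable (Set.mem_univ e)
  have hrot : ∀ d, R.dual.Reachable Set.univ (R.face d) (R.face (R.rot d)) := fun d => by
    rw [R.face_rot]; exact hflip d
  have horigin : ∀ d d', G.origin d = G.origin d' →
      R.dual.Reachable Set.univ (R.face d) (R.face d') := by
    have hpow : ∀ (n : ℕ) d, R.dual.Reachable Set.univ (R.face d) (R.face ((R.rot ^ n) d)) := by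
      intro n
      induction n with
      | zero => exact fun d => Relation.ReflTransGen.refl
      | succ n ih =>
        intro d
        rw [pow_succ', Equiv.Perm.mul_apply]
        exact (ih d).trans (hrot _)
    intro d d' h
    obtain ⟨n, hn⟩ := (R.sameCycle_iff d d').2 h
    obtain ⟨m, rfl | rfl⟩ := n.eq_nat_or_neg
    · rw [← hn, zpow_natCast]; exact hpow m d
    · have : d = (R.rot ^ m) d' := by
        rw [← hn, zpow_neg, zpow_natCast, ← Equiv.Perm.mul_apply, mul_inv_cancel, Equiv.Perm.one_apply]
      rw [this]; exact (hpow m d').symm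
  -- The faces around one vertex are already linked. A walk in `G` carries this from vertex to
  -- vertex, since the two darts of an edge lie on faces that are adjacent in the dual.
  have key : ∀ v, ∀ d, G.origin d = v →
      R.dual.Reachable Set.univ (R.face d₀) (R.face d) := by
    intro v
    have h := hG.2 (G.origin d₀) v
    induction h with
    | refl => exact fun d hd => horigin d₀ d hd.symm
    | tail _ h ih =>
      intro d hd
      obtain ⟨e, -, ⟨h1, h2⟩ | ⟨h1, h2⟩⟩ := h
      · exact ((ih (e, true) h1).trans (hflip _)).trans (horigin _ _ (h2.trans hd.symm))
      · exact ((ih (e, false) h2).trans (hflip _)).trans (horigin _ _ (h1.trans hd.symm))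
  exact key _ d₁ rfl

/-- The gradient on the dual graph of a function of the faces is a flow. -/
theorem isFlow_dual_incidence_mulVec [Fintype E] (h : R.Face → ℝ) :
    G.IsFlow (R.dual.incidence.mulVec h) := by
  classical
  ext v
  -- Reindexing by `rot` permutes the darts at `v` and turns the face on one side into the face on
  -- the other, so the differences around `v` cancel.
  have key : ∑ d : E × Bool, h (R.face (flip E d)) * (if G.origin d = v then 1 else 0) =
      ∑ d : E × Bool, h (R.face d) * (if G.origin d = v then 1 else 0) := by
    rw [← Equiv.sum_comp R.rot fun d => h (R.face d) * (if G.origin d = v then 1 else 0)]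
    simp only [R.face_rot, R.origin_rot]
  rw [Fintype.sum_prod_type, Fintype.sum_prod_type] at key
  simp only [Fintype.sum_bool] at key
  rw [← sub_eq_zero, ← Finset.sum_sub_distrib] at key
  rw [← neg_eq_zero, ← Finset.sum_neg_distrib] at key
  rw [← sub_eq_zero, ← key]
  simp only [Matrix.vecMul, dotProduct, incidence_mulVec, Pi.zero_apply, sub_zero]
  refine Finset.sum_congr rfl fun e _ => ?_
  simp only [incidence, dual, origin, flip, Matrix.of_apply, Equiv.prodCongr_apply, Prod.map,
    Equiv.refl_apply, Equiv.boolNot_apply, Bool.not_true, Bool.not_false, if_true,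
    Bool.false_eq_true, if_false]
  ring

/-- On a planar graph, every flow is the gradient of a function of the faces. -/
theorem IsPlanar.exists_potential [Fintype V] [Fintype E] (hR : R.IsPlanar) (hG : G.Connected)
    (b : R.Face) {θ : E → ℝ} (hθ : G.IsFlow θ) :
    ∃ h : R.Face → ℝ, h b = 0 ∧ R.dual.incidence.mulVec h = θ := by
  have hle : LinearMap.range R.dual.incidence.mulVecLin ≤
      LinearMap.ker G.incidence.transpose.mulVecLin := by
    rintro _ ⟨h, rfl⟩
    rw [LinearMap.mem_ker, Matrix.mulVecLin_apply, Matrix.mulVec_transpose]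
    exact isFlow_dual_incidence_mulVec h
  have h1 := hG.rank_incidence
  have h2 := (dual_connected hG b).rank_incidence
  have h3 := LinearMap.finrank_range_add_finrank_ker G.incidence.transpose.mulVecLin
  rw [Module.finrank_fintype_fun_eq_card] at h3
  have h4 : Module.finrank ℝ (LinearMap.range G.incidence.transpose.mulVecLin) =
    G.incidence.rank := Matrix.rank_transpose _
  have h5 : Module.finrank ℝ (LinearMap.range R.dual.incidence.mulVecLin) =
    R.dual.incidence.rank := rfl
  have h6 : Fintype.card V + Fintype.card R.Face = Fintype.card E + 2 := hR
  -- Gradients have dimension `|V*| - 1`, flows have dimension `|E| - (|V| - 1)`; planarity says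
  -- that these are equal.
  have heq := Submodule.eq_of_le_of_finrank_eq hle (by omega)
  have : θ ∈ LinearMap.range R.dual.incidence.mulVecLin := by
    rw [heq, LinearMap.mem_ker, Matrix.mulVecLin_apply, Matrix.mulVec_transpose]
    exact hθ
  obtain ⟨h, rfl⟩ := this
  refine ⟨fun f => h f - h b, sub_self _, ?_⟩
  ext e
  simp [incidence_mulVec]

/-- Functions of the faces that vanish at the outer face are determined by their gradient. -/
theorem eq_of_incidence_mulVec_eq [Fintype E] (hG : G.Connected) {b : R.Face} {h h' : R.Face → ℝ}
    (hb : h b = h' b) (hh : R.dual.incidence.mulVec h = R.dual.incidence.mulVec h') : h = h' := by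
  ext f
  have := (dual_connected hG b).eq_of_incidence_mulVec_eq_zero (h := h - h')
    (by rw [Matrix.mulVec_sub, hh, sub_self]) f b
  simp only [Pi.sub_apply] at this
  linarith

end RotationSystem

/-- A potential of the flow around the cycle of a unicycle is, up to the sign, the indicator
function of the faces that the cycle encloses. -/
theorem Unicycle.potential_eq [Fintype V] [Fintype E] (hG : G.Connected) {R : G.RotationSystem}
    {b : R.Face} (U : G.Unicycle) {h : R.Face → ℝ} (hb : h b = 0)
    (hh : R.dual.incidence.mulVec h = U.flow) : ∃ s : ℝ, s * s = 1 ∧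
      ∀ f, (R.Encloses b U.cycle f → h f = s) ∧ (¬ R.Encloses b U.cycle f → h f = 0) := by
  classical
  obtain ⟨e, he⟩ := U.isCycle_cycle.nonempty
  let k : R.Face → ℝ := fun f => if R.Encloses b U.cycle f then 1 else 0
  have hbb : ¬ R.Encloses b U.cycle b := fun h => h Relation.ReflTransGen.refl
  have hk0 : ∀ a ∉ U.cycle, R.dual.incidence.mulVec k a = 0 := fun a ha => by
    have hr : R.dual.Reachable U.cycleᶜ (R.dual.src a) (R.dual.tgt a) :=
      (R.dual.joins_src_tgt a).reachable ha
    have : R.Encloses b U.cycle (R.dual.src a) ↔ R.Encloses b U.cycle (R.dual.tgt a) :=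
      not_congr ⟨fun h => hr.symm.trans h, fun h => hr.trans h⟩
    simp [incidence_mulVec, k, this]
  -- The indicator `k` of the enclosed faces jumps only across the cycle, so its gradient is a flow
  -- on `U`, hence a multiple of `U.flow`.
  have h1 := U.eq_smul_flow he (RotationSystem.isFlow_dual_incidence_mulVec k) fun a ha =>
    hk0 a fun h' => ha (U.cycle_subset h')
  set t := R.dual.incidence.mulVec k e * U.flow e with ht
  have h2 : k = t • h := RotationSystem.eq_of_incidence_mulVec_eq hG (b := b)
    (by simp [k, hb, hbb]) (by rw [h1, Matrix.mulVec_smul, hh])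
  have hz : ∀ f, ¬ R.Encloses b U.cycle f → h f = 0 := fun f hf => by
    rw [← hb]
    refine (not_not.1 hf : R.dual.Reachable _ f b).eq_of_forall h fun a ha => ?_
    have h3 : R.dual.incidence.mulVec h a = 0 := by rw [hh]; exact U.flow_eq_zero ha
    rw [incidence_mulVec] at h3
    linarith
  -- If no face were enclosed, `h` would vanish identically, and so would the flow.
  have hex : ∃ f, R.Encloses b U.cycle f := by
    by_contra hcon
    push Not at hcon
    have : h = 0 := funext fun f => hz f (hcon f)
    rw [this, Matrix.mulVec_zero] at hh
    exact U.flow_ne_zero he (congrFun hh e).symm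
  obtain ⟨f₀, hf₀⟩ := hex
  have hk : ∀ f, R.Encloses b U.cycle f → t * h f = 1 := fun f hf => by
    have := congrFun h2 f
    simpa [k, hf] using this.symm
  have ht0 : t ≠ 0 := fun h0 => by simpa [h0] using hk f₀ hf₀
  refine ⟨t⁻¹, ?_, fun f => ⟨fun hf => eq_inv_of_mul_eq_one_right (hk f hf), hz f⟩⟩
  -- An indicator jumps by `0` or `±1` across `e`, so `t * t` is `0` or `1`, and `t ≠ 0`.
  have hs : (R.dual.incidence.mulVec k e) * (R.dual.incidence.mulVec k e) = 0 ∨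
      (R.dual.incidence.mulVec k e) * (R.dual.incidence.mulVec k e) = 1 := by
    rw [incidence_mulVec]
    simp only [k]
    split_ifs <;> norm_num
  have htt : t * t = 1 := by
    have e1 : t * t = R.dual.incidence.mulVec k e * R.dual.incidence.mulVec k e := by
      rw [ht, mul_mul_mul_comm, U.flow_mul_self he, mul_one]
    rcases hs with h0 | h0
    · rw [h0] at e1
      exact absurd (mul_self_eq_zero.1 e1) ht0
    · rw [e1, h0]
  rw [← mul_inv, htt, inv_one]

end Planar
end MGraph

namespace MGraph

/-! ### The Laplacian, its factorization and the Green's function -/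

section Laplacian

variable {V E : Type*} (G : MGraph V E) (c : E → ℝ)

theorem sum_incidence [Fintype V] (e : E) : ∑ v, G.incidence e v = 0 := by
  simpa [Matrix.mulVec, dotProduct] using congrFun (G.incidence_mulVec_one 1) e

open scoped Classical in
theorem incidence_mul_incidence {u v : V} (h : u ≠ v) (e : E) :
    G.incidence e u * G.incidence e v = if G.Joins e u v then -1 else 0 := by
  simp only [incidence, Matrix.of_apply, Joins]
  by_cases h1 : G.src e = u <;> by_cases h2 : G.tgt e = u <;>
    by_cases h3 : G.src e = v <;> by_cases h4 : G.tgt e = v <;> simp_all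

theorem neg_cond_eq_sum [Fintype E] {u v : V} (h : u ≠ v) :
    - G.cond c u v = ∑ e, G.incidence e u * c e * G.incidence e v := by
  classical
  unfold cond
  rw [Finset.sum_filter, ← Finset.sum_neg_distrib]
  refine Finset.sum_congr rfl fun e _ => ?_
  rw [mul_right_comm, G.incidence_mul_incidence h]
  split_ifs <;> simp

/-- The rows of the incidence matrix sum to zero, so the diagonal entry is minus the sum of the
off-diagonal ones. Loops have zero rows and drop out. -/
theorem rate_eq_sum [Fintype V] [Fintype E] (u : V) :
    G.rate c u = ∑ e, G.incidence e u * c e * G.incidence e u := by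
  classical
  have h : ∑ v, ∑ e, G.incidence e u * c e * G.incidence e v = 0 := by
    rw [Finset.sum_comm]
    refine Finset.sum_eq_zero fun e _ => ?_
    rw [← Finset.mul_sum, sum_incidence, mul_zero]
  rw [← Finset.sum_filter_add_sum_filter_not _ (fun v => v ≠ u)] at h
  have h1 : ∑ v : V with v ≠ u, ∑ e, G.incidence e u * c e * G.incidence e v = - G.rate c u := by
    unfold rate
    rw [← Finset.sum_neg_distrib]
    refine Finset.sum_congr (by congr!) fun v hv => ?_
    exact (G.neg_cond_eq_sum c (Finset.mem_filter.1 hv).2.symm).symm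
  rw [h1] at h
  have h2 : (Finset.univ.filter fun v : V => ¬ v ≠ u) = {u} := by ext; simp
  rw [h2, Finset.sum_singleton] at h
  linarith

/-- The Laplacian factors through the incidence matrix. -/
theorem laplacian_apply [Fintype V] [Fintype E] (u v : V) :
    G.laplacian c u v = ∑ e, G.incidence e u * c e * G.incidence e v := by
  classical
  by_cases h : u = v
  · subst h
    rw [← rate_eq_sum]
    simp [laplacian]
  · rw [← G.neg_cond_eq_sum c h]
    simp [laplacian, h]

variable {G c}

/-- With zero rate, the indicator of `u` would have zero gradient and be constant. -/
theorem Connected.rate_pos [Fintype V] [Fintype E] [Nontrivial V] (hG : G.Connected)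
    (hc : ∀ e, 0 < c e) (u : V) : 0 < G.rate c u := by
  classical
  have hnn : ∀ e, 0 ≤ G.incidence e u * c e * G.incidence e u := fun e => by
    rw [mul_right_comm]
    exact mul_nonneg (mul_self_nonneg _) (hc e).le
  rw [rate_eq_sum]
  refine lt_of_le_of_ne (Finset.sum_nonneg fun e _ => hnn e) fun h => ?_
  have h0 := (Finset.sum_eq_zero_iff_of_nonneg fun e _ => hnn e).1 h.symm
  obtain ⟨v, hv⟩ := exists_ne u
  have := hG.eq_of_incidence_mulVec_eq_zero (h := Pi.single u 1) (by
    ext e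
    have := h0 e (Finset.mem_univ e)
    have h1 : G.incidence e u = 0 := by
      rcases mul_eq_zero.1 this with h | h
      · exact (mul_eq_zero.1 h).resolve_right (hc e).ne'
      · exact h
    simpa using h1) u v
  simp [hv] at this

/-- A right inverse of a square matrix is its inverse, so invertibility of the Dirichlet Laplacian
need not be known beforehand. The factor `κ` is there for the application to sums over unicycles. -/
theorem green_of_right_inverse [DecidableEq V] [Fintype V] [Fintype E] {b : V} {H : V → V → ℝ} {κ : ℝ}
    (hκ : κ ≠ 0) (hb : ∀ u v, u = b ∨ v = b → H u v = 0)
    (hH : ∀ u ≠ b, ∀ v, v ≠ b → ∑ w, G.laplacian c u w * H w v = if u = v then κ else 0)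
    (u v : V) : H u v = κ * G.green c b u v := by
  unfold green
  split_ifs with h
  · let K : Matrix {v // v ≠ b} {v // v ≠ b} ℝ := Matrix.of fun u v => κ⁻¹ * H u v
    have hinv : G.dirichletLaplacian c b * K = 1 := by
      ext x y
      rw [Matrix.mul_apply]
      have h1 := hH x x.2 y y.2
      have h2 : ∑ w, G.laplacian c x w * H w y =
          ∑ w : {v // v ≠ b}, G.laplacian c x w * H w y := by
        rw [← Finset.sum_subset (Finset.subset_univ (Finset.univ.filter fun v => v ≠ b))
          (fun w _ hw => by rw [hb w y (Or.inl (by simpa using hw)), mul_zero])]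
        exact Finset.sum_subtype _ (by simp) _
      rw [h2] at h1
      calc ∑ w, G.dirichletLaplacian c b x w * K w y
          = κ⁻¹ * ∑ w : {v // v ≠ b}, G.laplacian c x w * H w y := by
            rw [Finset.mul_sum]
            refine Finset.sum_congr (by congr!) fun w _ => ?_
            simp only [dirichletLaplacian, Matrix.submatrix_apply, K, Matrix.of_apply]
            ring
        _ = (1 : Matrix {v // v ≠ b} {v // v ≠ b} ℝ) x y := by
            rw [h1, Matrix.one_apply]
            by_cases hxy : x = y
            · simp [hxy, hκ]
            · simp [hxy, Subtype.coe_injective.ne hxy]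
    have := Matrix.inv_eq_right_inv hinv
    convert_to _ = κ * K ⟨u, h.1⟩ ⟨v, h.2⟩
    · rw [← this]
      congr!
    · simp [K, hκ]
  · rw [mul_zero]
    exact hb u v (by tauto)

end Laplacian

/-! ### Potentials of unicycles and the Green's function of the dual -/

section Potential

/-- A set of edges that is a unicycle, as an element of the type of unicycles. -/
def IsUnicycle.toUnicycle {V E : Type*} {G : MGraph V E} {A : Finset E} (h : G.IsUnicycle A) :
    G.Unicycle := ⟨A, h⟩

variable {V E : Type*} [Fintype V] [Fintype E] {G : MGraph V E} (hG : G.Connected)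
  {R : G.RotationSystem} (hR : R.IsPlanar) (b : R.Face)

/-- The potential of the flow around the cycle of a unicycle, normalized at the outer face. -/
noncomputable def Unicycle.potential (hG : G.Connected) {R : G.RotationSystem} (hR : R.IsPlanar)
    (b : R.Face) (U : G.Unicycle) : R.Face → ℝ :=
  (hR.exists_potential hG b U.isFlow_flow).choose

theorem Unicycle.potential_outer (U : G.Unicycle) : U.potential hG hR b b = 0 :=
  (hR.exists_potential hG b U.isFlow_flow).choose_spec.1

theorem Unicycle.incidence_mulVec_potential (U : G.Unicycle) :
    R.dual.incidence.mulVec (U.potential hG hR b) = U.flow :=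
  (hR.exists_potential hG b U.isFlow_flow).choose_spec.2

open scoped Classical in
theorem Unicycle.potential_mul_potential (U : G.Unicycle) (f f' : R.Face) :
    U.potential hG hR b f * U.potential hG hR b f' =
      if R.Encloses b U.cycle f ∧ R.Encloses b U.cycle f' then 1 else 0 := by
  obtain ⟨s, hs, h⟩ := U.potential_eq hG (U.potential_outer hG hR b)
    (U.incidence_mulVec_potential hG hR b)
  by_cases h1 : R.Encloses b U.cycle f
  · by_cases h2 : R.Encloses b U.cycle f'
    · simp [h1, h2, (h f).1 h1, (h f').1 h2, hs]
    · simp [h2, (h f').2 h2]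
  · simp [h1, (h f).2 h1]

open scoped Classical in
/-- The potential of a unicycle `A`, oriented so that the flow at the edge `e` of the cycle
is positive. -/
noncomputable def edgePotential (hG : G.Connected) {R : G.RotationSystem} (hR : R.IsPlanar)
    (b : R.Face) (A : Finset E) (e : E) (f : R.Face) : ℝ :=
  if h : G.IsUnicycle A then
    h.toUnicycle.flow e * h.toUnicycle.potential hG hR b f else 0

/-- The fundamental cycles of a spanning tree generate the flows on the boundaries of the faces. -/
theorem IsSpanningTree.sum_edgePotential [DecidableEq E] [DecidableEq R.Face] {A : Finset E}
    (hA : G.IsSpanningTree A)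
    {f : R.Face} (hf : f ≠ b) (f' : R.Face) :
    ∑ e ∈ Aᶜ, R.dual.incidence e f * edgePotential hG hR b (insert e A) e f' =
      if f = f' then 1 else 0 := by
  classical
  -- `U e` is the flow around the fundamental cycle of `e`, with the sign that makes its value at
  -- `e` equal to one.
  let U : E → E → ℝ := fun e a => if h : G.IsUnicycle (insert e A) then
    h.toUnicycle.flow e * h.toUnicycle.flow a else 0
  have hP0 : ∀ e, edgePotential hG hR b (insert e A) e b = 0 := fun e => by
    unfold edgePotential
    split_ifs with h
    · rw [Unicycle.potential_outer, mul_zero]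
    · rfl
  have hPU : ∀ e, R.dual.incidence.mulVec (edgePotential hG hR b (insert e A) e) = U e := fun e => by
    by_cases h : G.IsUnicycle (insert e A)
    · have : edgePotential hG hR b (insert e A) e =
          h.toUnicycle.flow e • h.toUnicycle.potential hG hR b := by
        ext f; simp [edgePotential, h]
      rw [this, Matrix.mulVec_smul, Unicycle.incidence_mulVec_potential]
      ext a; simp [U, h]
    · have : edgePotential hG hR b (insert e A) e = 0 := by
        ext f; simp [edgePotential, h]
      rw [this, Matrix.mulVec_zero]
      ext a; simp [U, h]
  have hUe : ∀ e ∉ A, ∀ a ∉ A, U e a = if a = e then 1 else 0 := fun e he a ha => by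
    have h := hA.isUnicycle_insert he
    simp only [U, dif_pos h]
    split_ifs with hae
    · subst hae
      exact Unicycle.flow_mul_self _ (hA.mem_cycle_of_eq_insert h.toUnicycle rfl)
    · rw [h.toUnicycle.flow_eq_zero (e := a), mul_zero]
      intro h'
      rcases Finset.mem_insert.1 (h.toUnicycle.cycle_subset h') with h | h
      · exact hae h
      · exact ha h
  have hcol : R.dual.incidence.mulVec (Pi.single f 1) = fun e => R.dual.incidence e f := by
    ext e; simp
  have hflow : G.IsFlow (∑ e ∈ Aᶜ, R.dual.incidence e f • U e) := IsFlow.sum fun e he => by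
    rw [← hPU]
    exact (RotationSystem.isFlow_dual_incidence_mulVec _).smul _
  have hflow' : G.IsFlow fun e => R.dual.incidence e f := by
    rw [← hcol]
    exact RotationSystem.isFlow_dual_incidence_mulVec _
  -- Off the tree `U e` is the indicator of `e`, so both flows have the same values there, and a
  -- tree carries no nonzero flow.
  have hz := hA.eq_zero_of_isFlow (hflow.sub hflow') fun a ha => by
    rw [Pi.sub_apply, Finset.sum_apply, sub_eq_zero, Finset.sum_eq_single a]
    · simp [hUe a ha a ha]
    · intro e he hea
      simp [hUe e (Finset.mem_compl.1 he) a ha, hea.symm]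
    · intro h
      exact absurd (Finset.mem_compl.2 ha) h
  -- Equal gradients give equal potentials, because both sides vanish at `b`; here `f ≠ b` matters.
  have hp : ∑ e ∈ Aᶜ, R.dual.incidence e f • edgePotential hG hR b (insert e A) e =
      Pi.single f 1 := by
    refine RotationSystem.eq_of_incidence_mulVec_eq hG (b := b) ?_ ?_
    · simp [hP0, hf.symm]
    · rw [hcol, ← sub_eq_zero.1 hz, Matrix.mulVec_sum]
      exact Finset.sum_congr rfl fun e _ => by rw [Matrix.mulVec_smul, hPU]
  have := congrFun hp f'
  simp only [Finset.sum_apply, Pi.smul_apply, smul_eq_mul, Pi.single_apply] at this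
  rw [this]
  simp [eq_comm]

/-- Removing an edge of the cycle is a bijection between the pairs of a unicycle and an edge of its
cycle and the pairs of a spanning tree and an edge outside of it. -/
theorem sum_unicycle_erase [DecidableEq E] [DecidablePred G.IsSpanningTree] (e : E)
    [DecidablePred fun U : G.Unicycle => e ∈ U.cycle] (X : Finset E → ℝ) :
    ∑ U : G.Unicycle with e ∈ U.cycle, X (U.1.erase e) =
      ∑ A : Finset E with G.IsSpanningTree A ∧ e ∉ A, X A := by
  refine Finset.sum_bij (fun U _ => U.1.erase e) ?_ ?_ ?_ ?_
  · intro U hU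
    exact Finset.mem_filter.2 ⟨Finset.mem_univ _,
      U.isSpanningTree_erase (Finset.mem_filter.1 hU).2, Finset.notMem_erase _ _⟩
  · intro U hU U' hU' h
    have h1 := U.cycle_subset (Finset.mem_filter.1 hU).2
    have h1' := U'.cycle_subset (Finset.mem_filter.1 hU').2
    refine Subtype.ext ?_
    rw [← Finset.insert_erase h1, ← Finset.insert_erase h1']
    exact congrArg _ h
  · intro A hA
    obtain ⟨-, hA, he⟩ := Finset.mem_filter.1 hA
    refine ⟨(hA.isUnicycle_insert he).toUnicycle, ?_, Finset.erase_insert he⟩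
    exact Finset.mem_filter.2 ⟨Finset.mem_univ _, hA.mem_cycle_of_eq_insert _ rfl⟩
  · intro U hU
    rfl

variable {c : E → ℝ}

theorem treeSum_pos (hU : Nonempty G.Unicycle) (hc : ∀ e, 0 < c e) : 0 < G.treeSum c := by
  classical
  obtain ⟨U⟩ := hU
  obtain ⟨e, he⟩ := U.isCycle_cycle.nonempty
  unfold treeSum
  refine Finset.sum_pos (fun A _ => Finset.prod_pos fun e _ => hc e) ⟨U.1.erase e, ?_⟩
  simpa using U.isSpanningTree_erase he

/-- The central computation: `H` is `κ` times a right inverse of the Dirichlet Laplacian of the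
dual. -/
theorem sum_laplacian_mul_potential (hc : ∀ e, 0 < c e) [DecidableEq R.Face] {f : R.Face}
    (hf : f ≠ b) (f' : R.Face) :
    ∑ g, R.dual.laplacian (fun e => (c e)⁻¹) f g *
        ∑ U : G.Unicycle, U.weight c * (U.potential hG hR b g * U.potential hG hR b f') =
      if f = f' then G.treeSum c else 0 := by
  classical
  have hflow : ∀ (U : G.Unicycle) e, ∑ g, R.dual.incidence e g * U.potential hG hR b g = U.flow e :=
    fun U e => congrFun (U.incidence_mulVec_potential hG hR b) e
  calc _ = ∑ e, R.dual.incidence e f * ∑ U : G.Unicycle, (c e)⁻¹ * U.weight c *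
        (U.flow e * U.potential hG hR b f') := by
        simp only [laplacian_apply, Finset.sum_mul_sum]
        rw [Finset.sum_comm]
        refine Finset.sum_congr rfl fun e _ => ?_
        rw [Finset.sum_comm, Finset.mul_sum]
        refine Finset.sum_congr rfl fun U _ => ?_
        rw [← hflow, Finset.sum_mul, Finset.mul_sum, Finset.mul_sum]
        refine Finset.sum_congr rfl fun g _ => ?_
        ring
    -- The dual conductance `(c e)⁻¹` turns the weight of a unicycle into that of the tree left when
    -- `e` is removed; edges off the cycle carry no flow.
    _ = ∑ e, R.dual.incidence e f * ∑ A : Finset E with G.IsSpanningTree A ∧ e ∉ A,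
        (∏ a ∈ A, c a) * edgePotential hG hR b (insert e A) e f' := by
        refine Finset.sum_congr rfl fun e _ => ?_
        rw [← sum_unicycle_erase e fun A => (∏ a ∈ A, c a) *
          edgePotential hG hR b (insert e A) e f', Finset.sum_filter]
        congr 1
        refine Finset.sum_congr rfl fun U _ => ?_
        split_ifs with he
        · have heU : e ∈ U.1 := U.cycle_subset he
          rw [Finset.insert_erase heU, Unicycle.weight, ← Finset.mul_prod_erase _ _ heU,
            inv_mul_cancel_left₀ (hc e).ne', edgePotential, dif_pos U.2]
          rfl
        · rw [U.flow_eq_zero he, zero_mul, mul_zero]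
    _ = ∑ A : Finset E with G.IsSpanningTree A, (∏ a ∈ A, c a) *
        ∑ e ∈ Aᶜ, R.dual.incidence e f * edgePotential hG hR b (insert e A) e f' := by
        simp only [Finset.sum_filter, Finset.mul_sum]
        rw [Finset.sum_comm]
        refine Finset.sum_congr rfl fun A _ => ?_
        by_cases hA : G.IsSpanningTree A
        · simp only [hA, true_and, if_true]
          rw [← Finset.sum_subset (Finset.subset_univ Aᶜ)]
          · refine Finset.sum_congr rfl fun e he => ?_
            rw [if_pos (Finset.mem_compl.1 he)]
            ring
          · intro e _ he
            simp [Finset.mem_compl.not_left.1 he]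
        · simp [hA]
    _ = _ := by
        rw [Finset.sum_congr rfl fun A hA => by
          rw [(Finset.mem_filter.1 hA).2.sum_edgePotential hG hR b hf f']]
        rw [← Finset.sum_mul]
        simp [treeSum]

theorem sum_weight_mul_potential (hU : Nonempty G.Unicycle) (hc : ∀ e, 0 < c e) (f f' : R.Face) :
    ∑ U : G.Unicycle, U.weight c * (U.potential hG hR b f * U.potential hG hR b f') =
      G.treeSum c * R.dual.green (fun e => (c e)⁻¹) b f f' := by
  classical
  refine green_of_right_inverse (H := fun f f' => ∑ U : G.Unicycle, U.weight c *
    (U.potential hG hR b f * U.potential hG hR b f')) (treeSum_pos hU hc).ne' ?_ ?_ f f'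
  · rintro u v (rfl | rfl) <;> simp [Unicycle.potential_outer]
  · intro u hu v hv
    rw [sum_laplacian_mul_potential hG hR b hc hu v]

theorem unicycleProb_encloses (hG : G.Connected) (hR : R.IsPlanar) (hU : Nonempty G.Unicycle) (hc : ∀ e, 0 < c e) (f f' : R.Face) :
    G.unicycleProb c (fun U => R.Encloses b U.cycle f ∧ R.Encloses b U.cycle f') =
      G.treeSum c / G.unicycleSum c * R.dual.green (fun e => (c e)⁻¹) b f f' := by
  classical
  rw [div_mul_eq_mul_div, ← sum_weight_mul_potential hG hR b hU hc f f', Finset.sum_div]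
  unfold unicycleProb
  rw [Finset.sum_filter]
  refine Finset.sum_congr rfl fun U _ => ?_
  rw [U.potential_mul_potential]
  split_ifs <;> simp

/-- Up to the factor `κ > 0`, the Green's function is a sum of weights of unicycles, so no maximum
principle is needed. -/
theorem green_nonneg (hG : G.Connected) (hR : R.IsPlanar) (hU : Nonempty G.Unicycle)
    (hc : ∀ e, 0 < c e) (f f' : R.Face) : 0 ≤ R.dual.green (fun e => (c e)⁻¹) b f f' := by
  classical
  have h := sum_weight_mul_potential hG hR b hU hc f f'
  refine nonneg_of_mul_nonneg_right (h ▸ Finset.sum_nonneg fun U _ => ?_) (treeSum_pos hU hc)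
  rw [U.potential_mul_potential]
  refine mul_nonneg (Finset.prod_nonneg fun e _ => (hc e).le) ?_
  split_ifs <;> simp

/-- This is the Poisson equation that is used for the expected hitting time. -/
theorem sum_laplacian_mul_sum_green (hG : G.Connected) (hR : R.IsPlanar) (hU : Nonempty G.Unicycle) (hc : ∀ e, 0 < c e) {f : R.Face}
    (hf : f ≠ b) : ∑ g, R.dual.laplacian (fun e => (c e)⁻¹) f g *
      ∑ f', R.dual.green (fun e => (c e)⁻¹) b g f' = 1 := by
  classical
  have hκ := (treeSum_pos hU hc).ne'
  have h : ∀ f' ≠ b, ∑ g, R.dual.laplacian (fun e => (c e)⁻¹) f g *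
      R.dual.green (fun e => (c e)⁻¹) b g f' = if f = f' then 1 else 0 := fun f' _ => by
    have := sum_laplacian_mul_potential hG hR b hc hf f'
    simp only [sum_weight_mul_potential hG hR b hU hc, mul_left_comm _ (G.treeSum c)] at this
    rw [← Finset.mul_sum] at this
    apply mul_left_cancel₀ hκ
    rw [this]
    split_ifs <;> simp
  simp only [Finset.mul_sum]
  rw [Finset.sum_comm, Finset.sum_eq_single f]
  · rw [h f hf, if_pos rfl]
  · intro f' _ hne
    by_cases hb : f' = b
    · simp [hb, green]
    · rw [h f' hb, if_neg hne.symm]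
  · simp

/-- There is a face apart from the outer face. -/
theorem nontrivial_face (hG : G.Connected) (hR : R.IsPlanar) (b : R.Face)
    (hU : Nonempty G.Unicycle) : Nontrivial R.Face := by
  obtain ⟨U⟩ := hU
  obtain ⟨e, he⟩ := U.isCycle_cycle.nonempty
  by_contra h
  rw [not_nontrivial_iff_subsingleton] at h
  have h1 := congrFun (U.incidence_mulVec_potential hG hR b) e
  rw [incidence_mulVec, Subsingleton.elim (R.dual.tgt e) (R.dual.src e), sub_self] at h1
  exact U.flow_ne_zero he h1.symm

end Potential

open scoped Classical in
theorem RotationSystem.area_eq_sum {V E : Type*} [Fintype E] {G : MGraph V E}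
    (R : G.RotationSystem) (b : R.Face) (C : Set E) :
    (R.area b C : ℝ) = ∑ f, if R.Encloses b C f then 1 else 0 := by
  simp [RotationSystem.area, Set.ncard_eq_toFinset_card']

end MGraph

namespace MGraph

/-! ### The random walk and its expected hitting time -/

section JumpProb

variable {V E : Type*} [Fintype V] [Fintype E] (G : MGraph V E) {c : E → ℝ}

theorem jumpProb_nonneg (hc : ∀ e, 0 ≤ c e) (u v : V) : 0 ≤ G.jumpProb c u v := by
  unfold jumpProb
  split_ifs
  · exact le_rfl
  · exact div_nonneg (Finset.sum_nonneg fun e _ => hc e)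
      (Finset.sum_nonneg fun v _ => Finset.sum_nonneg fun e _ => hc e)

theorem sum_jumpProb {u : V} (hr : G.rate c u ≠ 0) : ∑ v, G.jumpProb c u v = 1 := by
  classical
  have h : ∑ v, G.jumpProb c u v = ∑ v : V with v ≠ u, G.cond c u v / G.rate c u := by
    rw [Finset.sum_filter]
    refine Finset.sum_congr rfl fun v _ => ?_
    by_cases h : u = v
    · simp [jumpProb, h]
    · simp [jumpProb, h, Ne.symm h]
  rw [h, ← Finset.sum_div, div_eq_one_iff_eq hr, rate]

end JumpProb

section Walk

variable {V E Ω : Type*} (X : ℕ → Ω → V) (T : ℕ → Ω → ℝ)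

/-- The event that the first `n + 1` steps of a walk are at vertices that satisfy `P`, take
positive time, and end at `v`. -/
def walkEvent (P : V → Prop) (n : ℕ) (v : V) : Set Ω :=
  {ω | X n ω = v ∧ ∀ i ≤ n, P (X i ω) ∧ 0 < T i ω}

/-- The event that the walk follows the path `x` in its first `n + 1` steps, and spends there more
than the times `t`. -/
def pathEvent (n : ℕ) (x : ℕ → V) (t : ℕ → ℝ) : Set Ω := {ω | ∀ i ≤ n, X i ω = x i ∧ t i < T i ω}

/-- The path given by a finite sequence, continued by its last vertex. -/
def pathOfFin {n : ℕ} (y : Fin (n + 1) → V) (i : ℕ) : V :=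
  y ⟨min i n, Nat.lt_succ_of_le (min_le_right i n)⟩

theorem pathOfFin_of_le {n : ℕ} (y : Fin (n + 1) → V) {i : ℕ} (hi : i ≤ n) :
    pathOfFin y i = y ⟨i, Nat.lt_succ_of_le hi⟩ := by
  unfold pathOfFin
  congr 2
  exact min_eq_left hi

open scoped Classical in
theorem walkEvent_eq_biUnion [Fintype V] (P : V → Prop) (n : ℕ) (v : V) :
    walkEvent X T P n v =
      ⋃ y ∈ (Finset.univ.filter fun y : Fin (n + 1) → V => y (Fin.last n) = v ∧ ∀ i, P (y i)),
        pathEvent X T n (pathOfFin y) 0 := by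
  ext ω
  simp only [walkEvent, pathEvent, Set.mem_iUnion, Finset.mem_filter, Finset.mem_univ, true_and,
    Set.mem_ofPred_eq, Pi.zero_apply, exists_prop]
  constructor
  · rintro ⟨rfl, h⟩
    refine ⟨fun i => X i ω, ⟨rfl, fun i => (h i (Nat.lt_succ_iff.1 i.2)).1⟩, fun i hi => ⟨?_, (h i hi).2⟩⟩
    rw [pathOfFin_of_le _ hi]
  · rintro ⟨y, ⟨hy, hP⟩, h⟩
    refine ⟨?_, fun i hi => ⟨?_, (h i hi).2⟩⟩
    · rw [(h n le_rfl).1, pathOfFin_of_le _ le_rfl]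
      exact hy
    · rw [(h i hi).1, pathOfFin_of_le _ hi]
      exact hP _

theorem pathEvent_disjoint {n : ℕ} {y y' : Fin (n + 1) → V} (h : y ≠ y') (t : ℕ → ℝ) :
    Disjoint (pathEvent X T n (pathOfFin y) t) (pathEvent X T n (pathOfFin y') t) := by
  rw [Set.disjoint_left]
  intro ω hω hω'
  refine h (funext fun i => ?_)
  have hi := Nat.lt_succ_iff.1 i.2
  have := (hω i hi).1.symm.trans (hω' i hi).1
  rwa [pathOfFin_of_le _ hi, pathOfFin_of_le _ hi] at this

variable {X T} [Fintype V] [Fintype E] [MeasurableSpace Ω] {G : MGraph V E} {c : E → ℝ}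
  {μ : Measure Ω}

namespace IsUniformWalk

variable (hW : G.IsUniformWalk c μ X T)
include hW

theorem measurableSet_pathEvent (n : ℕ) (x : ℕ → V) (t : ℕ → ℝ) :
    MeasurableSet (pathEvent X T n x t) := by
  have : pathEvent X T n x t = ⋂ i, ⋂ _ : i ≤ n, {ω | X i ω = x i} ∩ {ω | t i < T i ω} := by
    ext ω
    simp [pathEvent]
  rw [this]
  exact MeasurableSet.iInter fun i => MeasurableSet.iInter fun _ =>
    (hW.measurableSet_eq i _).inter (measurableSet_lt measurable_const (hW.measurable_time i))

theorem measurableSet_walkEvent (P : V → Prop) (n : ℕ) (v : V) :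
    MeasurableSet (walkEvent X T P n v) := by
  classical
  rw [walkEvent_eq_biUnion]
  exact Finset.measurableSet_biUnion _ fun y _ => hW.measurableSet_pathEvent _ _ _

/-- A conditional probability that depends only on the last vertex of a path is the same for all
the paths with this last vertex together. -/
theorem measure_walkEvent_inter {n : ℕ} {v : V} {D : Set Ω} (hD : MeasurableSet D) {k : ℝ≥0∞}
    (h : ∀ x, x n = v → μ (pathEvent X T n x 0 ∩ D) = k * μ (pathEvent X T n x 0))
    (P : V → Prop) : μ (walkEvent X T P n v ∩ D) = k * μ (walkEvent X T P n v) := by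
  classical
  rw [walkEvent_eq_biUnion, Set.iUnion₂_inter, measure_biUnion_finset, measure_biUnion_finset,
    Finset.mul_sum]
  · refine Finset.sum_congr rfl fun y hy => h _ ?_
    rw [pathOfFin_of_le _ le_rfl]
    exact (Finset.mem_filter.1 hy).2.1
  · exact fun y _ y' _ hne => pathEvent_disjoint X T hne 0
  · exact fun y _ => hW.measurableSet_pathEvent _ _ _
  · exact fun y _ y' _ hne => (pathEvent_disjoint X T hne 0).mono Set.inter_subset_left
      Set.inter_subset_left
  · exact fun y _ => (hW.measurableSet_pathEvent _ _ _).inter hD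

theorem measure_pathEvent_zero (n : ℕ) (x : ℕ → V) :
    μ (pathEvent X T n x 0) = ENNReal.ofReal ((Fintype.card V : ℝ)⁻¹ *
      ∏ i ∈ Finset.range n, G.jumpProb c (x i) (x (i + 1))) := by
  have := hW.law n x 0 fun i => le_rfl
  simpa [pathEvent] using this

theorem measure_walkEvent_inter_lt (P : V → Prop) (n : ℕ) (v : V) {t : ℝ} (ht : 0 ≤ t) :
    μ (walkEvent X T P n v ∩ {ω | t < T n ω}) =
      ENNReal.ofReal (Real.exp (- (G.rate c v * t))) * μ (walkEvent X T P n v) := by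
  refine hW.measure_walkEvent_inter (measurableSet_lt measurable_const (hW.measurable_time n)) ?_ P
  rintro x rfl
  -- In the law of the walk, a threshold is imposed on the last holding time only; all other
  -- thresholds are zero.
  have hset : pathEvent X T n x 0 ∩ {ω | t < T n ω} = pathEvent X T n x (Pi.single n t) := by
    ext ω
    constructor
    · rintro ⟨h, h'⟩ i hi
      refine ⟨(h i hi).1, ?_⟩
      by_cases hin : i = n
      · subst hin; simpa using h'
      · simpa [hin] using (h i hi).2
    · intro h
      refine ⟨fun i hi => ⟨(h i hi).1, ?_⟩, by simpa using (h n le_rfl).2⟩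
      by_cases hin : i = n
      · subst hin; exact ht.trans_lt (by simpa using (h i hi).2)
      · simpa [hin] using (h i hi).2
  have h1 := hW.law n x (Pi.single n t) fun i => by
    by_cases hin : i = n
    · subst hin; simpa using ht
    · simp [hin]
  have hprod : ∏ i ∈ Finset.range (n + 1),
      Real.exp (-(G.rate c (x i) * (Pi.single n t : ℕ → ℝ) i)) =
        Real.exp (-(G.rate c (x n) * t)) := by
    rw [Finset.prod_eq_single n (fun i _ hi => by simp [hi]) (by simp)]
    simp
  rw [hset, hW.measure_pathEvent_zero, pathEvent, h1, hprod, mul_comm,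
    ENNReal.ofReal_mul (Real.exp_pos _).le]

theorem measure_walkEvent_inter_next (hc : ∀ e, 0 ≤ c e) (P : V → Prop) (n : ℕ) (v w : V) :
    μ (walkEvent X T P n v ∩ {ω | X (n + 1) ω = w ∧ 0 < T (n + 1) ω}) =
      ENNReal.ofReal (G.jumpProb c v w) * μ (walkEvent X T P n v) := by
  have hm : MeasurableSet {ω | X (n + 1) ω = w ∧ 0 < T (n + 1) ω} :=
    (hW.measurableSet_eq _ _).inter (measurableSet_lt measurable_const (hW.measurable_time _))
  refine hW.measure_walkEvent_inter hm ?_ P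
  rintro x rfl
  have hset : pathEvent X T n x 0 ∩ {ω | X (n + 1) ω = w ∧ 0 < T (n + 1) ω} =
      pathEvent X T (n + 1) (Function.update x (n + 1) w) 0 := by
    ext ω
    constructor
    · rintro ⟨h, h'⟩ i hi
      by_cases hin : i = n + 1
      · subst hin; simpa using h'
      · simpa [hin] using h i (by omega)
    · intro h
      refine ⟨fun i hi => ?_, by simpa using h (n + 1) le_rfl⟩
      have hin : i ≠ n + 1 := by omega
      simpa [hin] using h i (by omega)
  rw [hset, hW.measure_pathEvent_zero, hW.measure_pathEvent_zero, Finset.prod_range_succ,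
    ← ENNReal.ofReal_mul (G.jumpProb_nonneg hc _ _)]
  congr 1
  rw [Finset.prod_congr rfl (g := fun i => G.jumpProb c (x i) (x (i + 1))) fun i hi => by
    have := Finset.mem_range.1 hi
    rw [Function.update_of_ne (by omega), Function.update_of_ne (by omega)]]
  rw [Function.update_of_ne (by omega), Function.update_self]
  ring

theorem measure_walkEvent_succ (hc : ∀ e, 0 ≤ c e) (P : V → Prop) [DecidablePred P] (n : ℕ)
    (w : V) : μ (walkEvent X T P (n + 1) w) =
      if P w then ∑ v, ENNReal.ofReal (G.jumpProb c v w) * μ (walkEvent X T P n v) else 0 := by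
  split_ifs with hw
  · have hset : walkEvent X T P (n + 1) w = ⋃ v ∈ (Finset.univ : Finset V),
        walkEvent X T P n v ∩ {ω | X (n + 1) ω = w ∧ 0 < T (n + 1) ω} := by
      ext ω
      simp only [walkEvent, Set.mem_iUnion, Finset.mem_univ, Set.mem_ofPred_eq, Set.mem_inter_iff,
        exists_prop, true_and]
      constructor
      · rintro ⟨h, h'⟩
        exact ⟨X n ω, ⟨rfl, fun i hi => h' i (by omega)⟩, h, (h' _ le_rfl).2⟩
      · rintro ⟨v, ⟨h, h'⟩, h1, h2⟩
        refine ⟨h1, fun i hi => ?_⟩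
        rcases Nat.le_succ_iff.1 hi with hi | rfl
        · exact h' i hi
        · exact ⟨h1.symm ▸ hw, h2⟩
    rw [hset, measure_biUnion_finset]
    · exact Finset.sum_congr rfl fun v _ => hW.measure_walkEvent_inter_next hc P n v w
    · intro v _ v' _ hne
      refine Set.disjoint_left.2 fun ω h h' => hne (h.1.1.symm.trans h'.1.1)
    · exact fun v _ => (hW.measurableSet_walkEvent _ _ _).inter ((hW.measurableSet_eq _ _).inter
        (measurableSet_lt measurable_const (hW.measurable_time _)))
  · rw [← measure_empty (μ := μ)]
    congr 1
    refine Set.eq_empty_of_forall_notMem fun ω h => hw ?_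
    have := (h.2 (n + 1) le_rfl).1
    rwa [h.1] at this

theorem measure_walkEvent_zero (P : V → Prop) [DecidablePred P] (v : V) :
    μ (walkEvent X T P 0 v) = if P v then ENNReal.ofReal (Fintype.card V : ℝ)⁻¹ else 0 := by
  split_ifs with hv
  · have hset : walkEvent X T P 0 v = pathEvent X T 0 (fun _ => v) 0 := by
      ext ω
      simp only [walkEvent, pathEvent, Set.mem_ofPred_eq, Nat.le_zero, forall_eq, Pi.zero_apply]
      constructor
      · rintro ⟨h, h'⟩
        exact ⟨h, h'.2⟩
      · rintro ⟨h, h'⟩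
        exact ⟨h, h.symm ▸ hv, h'⟩
    rw [hset, hW.measure_pathEvent_zero]
    simp
  · rw [← measure_empty (μ := μ)]
    congr 1
    refine Set.eq_empty_of_forall_notMem fun ω h => hv ?_
    have := (h.2 0 le_rfl).1
    rwa [h.1] at this

/-- The walk almost surely spends a positive time at every step. -/
theorem ae_time_pos (hc : ∀ e, 0 ≤ c e) (hr : ∀ u, 0 < G.rate c u) :
    ∀ᵐ ω ∂μ, ∀ i, 0 < T i ω := by
  classical
  have := hW.isProbabilityMeasure
  have hV : Nonempty V := by
    obtain ⟨ω⟩ := nonempty_of_isProbabilityMeasure μ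
    exact ⟨X 0 ω⟩
  -- No mass is lost from step to step, since the jump probabilities sum to one; the event of
  -- positive holding times up to step `n` therefore has full measure.
  have hsum : ∀ n, ∑ v, μ (walkEvent X T (fun _ => True) n v) = 1 := by
    intro n
    induction n with
    | zero =>
      simp only [hW.measure_walkEvent_zero, if_true, Finset.sum_const, nsmul_eq_mul,
        Finset.card_univ]
      rw [ENNReal.ofReal_inv_of_pos (by exact_mod_cast Fintype.card_pos), ENNReal.ofReal_natCast,
        ENNReal.mul_inv_cancel (by simp) (by simp)]
    | succ n ih =>
      simp only [hW.measure_walkEvent_succ hc, if_true]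
      rw [Finset.sum_comm, ← ih]
      refine Finset.sum_congr rfl fun v _ => ?_
      rw [← Finset.sum_mul, ← ENNReal.ofReal_sum_of_nonneg fun w _ => G.jumpProb_nonneg hc v w,
        G.sum_jumpProb (hr v).ne', ENNReal.ofReal_one, one_mul]
  rw [ae_all_iff]
  intro n
  have hle : (⋃ v ∈ (Finset.univ : Finset V), walkEvent X T (fun _ => True) n v) ⊆
      {ω | 0 < T n ω} := by
    intro ω hω
    simp only [Set.mem_iUnion] at hω
    obtain ⟨v, -, h⟩ := hω
    exact (h.2 n le_rfl).2
  have h1 : μ (⋃ v ∈ (Finset.univ : Finset V), walkEvent X T (fun _ => True) n v) = 1 := by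
    rw [measure_biUnion_finset, hsum]
    · intro v _ v' _ hne
      exact Set.disjoint_left.2 fun ω h h' => hne (h.1.symm.trans h'.1)
    · exact fun v _ => hW.measurableSet_walkEvent _ _ _
  have hm : MeasurableSet {ω | 0 < T n ω} :=
    measurableSet_lt measurable_const (hW.measurable_time n)
  exact (prob_compl_eq_zero_iff hm).2 (le_antisymm prob_le_one (h1 ▸ measure_mono hle))

/-- Integrate the tail of the holding time: given the event, it is exponential with mean `1 / rate`.
-/
theorem setLIntegral_walkEvent (hr : ∀ u, 0 < G.rate c u) (P : V → Prop) (n : ℕ) (v : V) :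
    ∫⁻ ω in walkEvent X T P n v, ENNReal.ofReal (T n ω) ∂μ =
      ENNReal.ofReal (G.rate c v)⁻¹ * μ (walkEvent X T P n v) := by
  have hm := hW.measurableSet_walkEvent P n v
  rw [lintegral_eq_lintegral_meas_lt _ _ (hW.measurable_time n).aemeasurable]
  · have h1 : ∀ t ∈ Set.Ioi (0 : ℝ), (μ.restrict (walkEvent X T P n v)) {ω | t < T n ω} =
        ENNReal.ofReal (Real.exp (- G.rate c v * t)) * μ (walkEvent X T P n v) := fun t ht => by
      rw [Measure.restrict_apply (measurableSet_lt measurable_const (hW.measurable_time n)),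
        Set.inter_comm, hW.measure_walkEvent_inter_lt P n v (le_of_lt ht), neg_mul]
    have hneg : - G.rate c v < 0 := neg_lt_zero.2 (hr v)
    rw [setLIntegral_congr_fun measurableSet_Ioi h1, lintegral_mul_const _ (by fun_prop),
      ← ofReal_integral_eq_lintegral_ofReal (integrableOn_exp_mul_Ioi hneg 0)
        (Filter.Eventually.of_forall fun t => (Real.exp_pos _).le), integral_exp_mul_Ioi hneg]
    congr 2
    rw [mul_zero, Real.exp_zero, neg_div_neg_eq, one_div]
  · filter_upwards [ae_restrict_mem hm] with ω hω
    exact (hω.2 n le_rfl).2.le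

theorem lintegral_hittingTime_eq_tsum (hc : ∀ e, 0 ≤ c e) (hr : ∀ u, 0 < G.rate c u) (b : V) :
    ∫⁻ ω, hittingTime X T b ω ∂μ =
      ∑' n, ∑ v, ENNReal.ofReal (G.rate c v)⁻¹ * μ (walkEvent X T (· ≠ b) n v) := by
  classical
  have hae : ∀ᵐ ω ∂μ, hittingTime X T b ω = ∑' n, ∑ v,
      (walkEvent X T (· ≠ b) n v).indicator (fun ω => ENNReal.ofReal (T n ω)) ω := by
    filter_upwards [hW.ae_time_pos hc hr] with ω hω
    unfold hittingTime
    congr 1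
    ext n
    rw [Finset.sum_eq_single (X n ω)]
    · simp [Set.indicator_apply, walkEvent, hω]
    · intro v _ hv
      exact Set.indicator_of_notMem (fun h => hv h.1.symm) _
    · simp
  have hmeas : ∀ n v, Measurable
      ((walkEvent X T (· ≠ b) n v).indicator fun ω => ENNReal.ofReal (T n ω)) := fun n v =>
    ((hW.measurable_time n).ennreal_ofReal).indicator (hW.measurableSet_walkEvent _ _ _)
  rw [lintegral_congr_ae hae, lintegral_tsum fun n =>
    (Finset.measurable_fun_sum _ fun v _ => hmeas n v).aemeasurable]
  congr 1
  ext n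
  rw [lintegral_finsetSum _ fun v _ => hmeas n v]
  refine Finset.sum_congr rfl fun v _ => ?_
  rw [lintegral_indicator (hW.measurableSet_walkEvent _ _ _), hW.setLIntegral_walkEvent hr]

/-- The expected hitting time is given by a solution of the Poisson equation. -/
theorem lintegral_hittingTime (hc : ∀ e, 0 ≤ c e) (hr : ∀ u, 0 < G.rate c u) {b : V} {g : V → ℝ}
    (hg0 : ∀ v, 0 ≤ g v) (hgb : g b = 0) (hg : ∀ u ≠ b, ∑ w, G.laplacian c u w * g w = 1) :
    ∫⁻ ω, hittingTime X T b ω ∂μ = ENNReal.ofReal ((Fintype.card V : ℝ)⁻¹ * ∑ v, g v) := by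
  classical
  have := hW.isProbabilityMeasure
  -- `p n v` is the probability of being at `v` at step `n` without having met `b`; `s n` below is
  -- the expected time spent at that step before hitting `b`.
  let p : ℕ → V → ℝ := fun n v => μ.real (walkEvent X T (· ≠ b) n v)
  have hp0 : ∀ n v, 0 ≤ p n v := fun n v => measureReal_nonneg
  have hpb : ∀ n, p n b = 0 := fun n => by
    have : walkEvent X T (· ≠ b) n b = ∅ :=
      Set.eq_empty_of_forall_notMem fun ω h => (h.2 n le_rfl).1 h.1
    simp [p, this]
  have hinit : ∀ v, p 0 v = if v ≠ b then (Fintype.card V : ℝ)⁻¹ else 0 := fun v => by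
    simp only [p, Measure.real, hW.measure_walkEvent_zero]
    split_ifs <;> simp
  have hrec : ∀ n, ∀ w ≠ b, p (n + 1) w = ∑ v, G.jumpProb c v w * p n v := fun n w hw => by
    simp only [p, Measure.real, hW.measure_walkEvent_succ hc, if_pos hw]
    rw [ENNReal.toReal_sum fun v _ => ENNReal.mul_ne_top ENNReal.ofReal_ne_top (measure_ne_top _ _)]
    refine Finset.sum_congr rfl fun v _ => ?_
    rw [ENNReal.toReal_mul, ENNReal.toReal_ofReal (G.jumpProb_nonneg hc v w)]
  let s : ℕ → ℝ := fun n => ∑ v, (G.rate c v)⁻¹ * p n v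
  have hs0 : ∀ n, 0 ≤ s n := fun n =>
    Finset.sum_nonneg fun v _ => mul_nonneg (inv_nonneg.2 (hr v).le) (hp0 n v)
  -- This is the Poisson equation divided by the rate: one jump lowers the mean of `g` by the mean
  -- holding time.
  have hjump : ∀ v ≠ b, ∑ w, G.jumpProb c v w * g w = g v - (G.rate c v)⁻¹ := fun v hv => by
    have h1 := hg v hv
    have h2 : ∀ w, G.laplacian c v w * g w =
        (if v = w then G.rate c v * g v else 0) - G.rate c v * (G.jumpProb c v w * g w) := by
      intro w
      have := (hr v).ne'
      by_cases h : v = w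
      · subst h
        simp [laplacian, jumpProb]
      · simp only [laplacian, jumpProb, Matrix.of_apply, if_neg h]
        field_simp
        ring
    rw [Finset.sum_congr rfl fun w _ => h2 w, Finset.sum_sub_distrib, ← Finset.mul_sum] at h1
    simp only [Finset.sum_ite_eq, Finset.mem_univ, if_true] at h1
    have := (hr v).ne'
    field_simp
    linarith
  -- Mass that jumps to `b` is absent from `p (n + 1)`, but `g b = 0`, so nothing is lost and the
  -- sums of `s` telescope.
  have hstep : ∀ n, ∑ w, p (n + 1) w * g w = ∑ v, p n v * g v - s n := fun n => by
    calc ∑ w, p (n + 1) w * g w = ∑ w, ∑ v, G.jumpProb c v w * p n v * g w := by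
          refine Finset.sum_congr rfl fun w _ => ?_
          by_cases hw : w = b
          · simp [hw, hgb]
          · rw [hrec n w hw, Finset.sum_mul]
      _ = ∑ v, p n v * ∑ w, G.jumpProb c v w * g w := by
          rw [Finset.sum_comm]
          refine Finset.sum_congr rfl fun v _ => ?_
          rw [Finset.mul_sum]
          exact Finset.sum_congr rfl fun w _ => by ring
      _ = _ := by
          rw [← Finset.sum_sub_distrib]
          refine Finset.sum_congr rfl fun v _ => ?_
          by_cases hv : v = b
          · simp [hv, hpb]
          · rw [hjump v hv]
            ring
  have hpart : ∀ N, ∑ n ∈ Finset.range N, s n =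
      (Fintype.card V : ℝ)⁻¹ * ∑ v, g v - ∑ v, p N v * g v := by
    intro N
    induction N with
    | zero =>
      rw [Finset.sum_range_zero, Finset.mul_sum, ← Finset.sum_sub_distrib]
      refine (Finset.sum_eq_zero fun v _ => ?_).symm
      rw [hinit]
      by_cases hv : v = b <;> simp [hv, hgb]
    | succ N ih =>
      rw [Finset.sum_range_succ, ih, hstep]
      ring
  have hsum : Summable s := summable_of_sum_range_le hs0 (c := (Fintype.card V : ℝ)⁻¹ * ∑ v, g v)
    fun N => by
      rw [hpart]
      exact sub_le_self _ (Finset.sum_nonneg fun v _ => mul_nonneg (hp0 N v) (hg0 v))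
  -- Since `p n v ≤ rate v * s n` and `s` is summable, the remainder of the telescoping sum tends to
  -- zero.
  have hplim : ∀ v, Filter.Tendsto (fun n => p n v) Filter.atTop (nhds 0) := fun v => by
    refine squeeze_zero (fun n => hp0 n v) (fun n => ?_)
      (by simpa using hsum.tendsto_atTop_zero.const_mul (G.rate c v))
    calc p n v = G.rate c v * ((G.rate c v)⁻¹ * p n v) := (mul_inv_cancel_left₀ (hr v).ne' _).symm
      _ ≤ G.rate c v * s n := by
          refine mul_le_mul_of_nonneg_left ?_ (hr v).le
          exact Finset.single_le_sum (f := fun v => (G.rate c v)⁻¹ * p n v)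
            (fun u _ => mul_nonneg (inv_nonneg.2 (hr u).le) (hp0 n u)) (Finset.mem_univ v)
  have hhas : HasSum s ((Fintype.card V : ℝ)⁻¹ * ∑ v, g v) := by
    rw [hasSum_iff_tendsto_nat_of_nonneg hs0]
    simp only [hpart]
    have h1 : Filter.Tendsto (fun n => ∑ v, p n v * g v) Filter.atTop (nhds 0) := by
      simpa using tendsto_finsetSum Finset.univ fun v _ => (hplim v).mul_const (g v)
    simpa using h1.const_sub ((Fintype.card V : ℝ)⁻¹ * ∑ v, g v)
  rw [hW.lintegral_hittingTime_eq_tsum hc hr, ← hhas.tsum_eq,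
    ENNReal.ofReal_tsum_of_nonneg hs0 hsum]
  congr 1
  ext n
  rw [ENNReal.ofReal_sum_of_nonneg fun v _ => mul_nonneg (inv_nonneg.2 (hr v).le) (hp0 n v)]
  refine Finset.sum_congr rfl fun v _ => ?_
  rw [ENNReal.ofReal_mul (inv_nonneg.2 (hr v).le)]
  congr 1
  exact (ofReal_measureReal (measure_ne_top _ _)).symm

end IsUniformWalk

end Walk
end MGraph

/-! ### The theorem: enclosure probabilities and moments of the area -/

theorem mainTheorem5 {V E : Type*} [Fintype V] [Fintype E]
    (G : MGraph V E) (hG : G.Connected) (hU : Nonempty G.Unicycle)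
    (R : G.RotationSystem) (hR : R.IsPlanar) (b : R.Face)
    (c : E → ℝ) (hc : ∀ e, 0 < c e) :
    (∀ f : R.Face,
      G.unicycleProb c (fun U => R.Encloses b U.cycle f) =
        G.treeSum c / G.unicycleSum c * R.dual.green (fun e => (c e)⁻¹) b f f) ∧
    (∀ f f' : R.Face,
      G.unicycleProb c (fun U => R.Encloses b U.cycle f ∧ R.Encloses b U.cycle f') =
        G.treeSum c / G.unicycleSum c * R.dual.green (fun e => (c e)⁻¹) b f f') ∧
    G.unicycleExp c (fun U => (R.area b U.cycle : ℝ)) =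
      G.treeSum c / G.unicycleSum c *
        ∑ v : R.Face, R.dual.green (fun e => (c e)⁻¹) b v v ∧
    (∀ {Ω : Type*} [MeasurableSpace Ω] (μ : MeasureTheory.Measure Ω)
      (X : ℕ → Ω → R.Face) (T : ℕ → Ω → ℝ),
      R.dual.IsUniformWalk (fun e => (c e)⁻¹) μ X T →
      ∫⁻ ω, hittingTime X T b ω ∂μ ≠ ⊤ ∧
      G.unicycleExp c (fun U => (R.area b U.cycle : ℝ) ^ 2) =
        G.treeSum c / G.unicycleSum c * (Fintype.card R.Face : ℝ) *
          (∫⁻ ω, hittingTime X T b ω ∂μ).toReal) := by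
  classical
  have hpair := fun f f' => MGraph.unicycleProb_encloses b hG hR hU hc f f'
  have hsingle : ∀ f, G.unicycleProb c (fun U => R.Encloses b U.cycle f) =
      G.treeSum c / G.unicycleSum c * R.dual.green (fun e => (c e)⁻¹) b f f := fun f => by
    rw [← hpair f f]
    simp only [and_self]
  refine ⟨hsingle, hpair, ?_, fun μ X T hW => ?_⟩
  · rw [Finset.mul_sum, ← Finset.sum_congr rfl fun f _ => hsingle f]
    simp only [MGraph.unicycleExp, MGraph.unicycleProb, R.area_eq_sum, Finset.mul_sum]
    rw [Finset.sum_comm]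
    refine Finset.sum_congr rfl fun f _ => ?_
    rw [Finset.sum_filter]
    simp
  · have := MGraph.nontrivial_face hG hR b hU
    have hc' : ∀ e, 0 < (c e)⁻¹ := fun e => inv_pos.2 (hc e)
    have hhit := hW.lintegral_hittingTime (fun e => (hc' e).le)
      ((MGraph.RotationSystem.dual_connected hG b).rate_pos hc') (b := b)
      (g := fun f => ∑ f', R.dual.green (fun e => (c e)⁻¹) b f f')
      (fun f => Finset.sum_nonneg fun f' _ => MGraph.green_nonneg b hG hR hU hc f f')
      (by simp [MGraph.green]) fun f hf => MGraph.sum_laplacian_mul_sum_green b hG hR hU hc hf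
    rw [hhit]
    refine ⟨ENNReal.ofReal_ne_top, ?_⟩
    have hcard : (Fintype.card R.Face : ℝ) ≠ 0 := by exact_mod_cast Fintype.card_ne_zero
    -- The factor `|V*|` cancels the `1 / |V*|` of the uniform starting point. What remains is the
    -- sum of the pair probabilities, the expectation of the square of a sum of indicators.
    rw [ENNReal.toReal_ofReal (mul_nonneg (by positivity) (Finset.sum_nonneg fun f _ =>
      Finset.sum_nonneg fun f' _ => MGraph.green_nonneg b hG hR hU hc f f')), mul_assoc,
      mul_inv_cancel_left₀ hcard, Finset.mul_sum]
    simp only [Finset.mul_sum, ← hpair]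
    simp only [MGraph.unicycleExp, MGraph.unicycleProb, R.area_eq_sum, sq, Finset.mul_sum,
      Finset.sum_filter]
    rw [Finset.sum_comm]
    refine Finset.sum_congr rfl fun f _ => ?_
    rw [Finset.sum_comm]
    refine Finset.sum_congr rfl fun U _ => ?_
    rw [Finset.sum_mul, Finset.mul_sum]
    refine Finset.sum_congr rfl fun f' _ => ?_
    by_cases h1 : R.Encloses b U.cycle f <;> by_cases h2 : R.Encloses b U.cycle f' <;> simp [h1, h2]
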